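/- A partition is a $t$-core if none of the hook lengths of its Young diagram is a multiple of $t$. For $n\ge 0$ let $A_3(n)$ denote the number of ordered pairs $(\lambda_1,\lambda_2)$ of partitions (the empty partition being allowed) such that $\lambda_1$ and $\lambda_2$ are both $3$-cores and the sum of all parts of $\lambda_1$ and $\lambda_2$ equals $n$. Let $p$ be a prime and let $k,n$ be nonnegative integers. (1) If $p\equiv 1 \pmod 3$, then \[A_{3}\Big(p^kn+\frac{2p^{k}-2}{3}\Big)=\frac{p^{k}-1}{p-1}\,A_{3}\Big(pn+\frac{2p-2}{3}\Big)-\frac{p^{k}-p}{p-1}\,A_{3}(n).\] (2) If $p\equiv 2 \pmod 3$, then \[A_{3}\Big(p^{2k}n+\frac{2p^{2k}-2}{3}\Big)=\frac{p^{2k}-1}{p^2-1}\,A_{3}\Big(p^2n+\frac{2p^2-2}{3}\Big)-\frac{p^{2k}-p^2}{p^2-1}\,A_{3}(n).\] -/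

import Mathlib

/-- The hook length of the cell `(i, j)` of a Young diagram: the number of cells to its right in
its row, plus the number of cells below it in its column, plus one for the cell itself. -/
def YoungDiagram.hookLength (μ : YoungDiagram) (i j : ℕ) : ℕ :=
  (μ.rowLen i - (j + 1)) + (μ.colLen j - (i + 1)) + 1

/-- A partition (given by its Young diagram) is a `t`-core if none of the hook lengths of its cells
is a multiple of `t`. -/
def YoungDiagram.IsCore (t : ℕ) (μ : YoungDiagram) : Prop :=
  ∀ i j : ℕ, (i, j) ∈ μ → ¬ t ∣ μ.hookLength i j

/-- The (ordered) pairs of partitions of total size `n` in which both partitions are `t`-cores.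
The empty partition is allowed. -/
def corePairs (t n : ℕ) : Set (YoungDiagram × YoungDiagram) :=
  {P | P.1.card + P.2.card = n ∧ P.1.IsCore t ∧ P.2.IsCore t}

/-- `A_t(n)`: the number of partition pairs of `n` with `t`-cores. The set counted is finite, see
`corePairs_finite`. -/
noncomputable def numCorePairs (t n : ℕ) : ℕ := (corePairs t n).ncard

theorem YoungDiagram.cells_subset_of_card_le {μ : YoungDiagram} {n : ℕ} (h : μ.card ≤ n) :
    μ.cells ⊆ Finset.range n ×ˢ Finset.range n := by
  rintro ⟨i, j⟩ hc
  have hc' : (i, j) ∈ μ := hc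
  have h1 : i < μ.colLen j := YoungDiagram.mem_iff_lt_colLen.1 hc'
  have h2 : j < μ.rowLen i := YoungDiagram.mem_iff_lt_rowLen.1 hc'
  have h3 : μ.colLen j ≤ μ.card := by
    rw [YoungDiagram.colLen_eq_card]
    exact Finset.card_le_card (Finset.filter_subset _ _)
  have h4 : μ.rowLen i ≤ μ.card := by
    rw [YoungDiagram.rowLen_eq_card]
    exact Finset.card_le_card (Finset.filter_subset _ _)
  simp only [Finset.mem_product, Finset.mem_range]
  omega

theorem YoungDiagram.finite_card_le (n : ℕ) : {μ : YoungDiagram | μ.card ≤ n}.Finite := by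
  refine Set.Finite.of_finite_image (f := YoungDiagram.cells) ?_
    (fun μ _ ν _ h => YoungDiagram.ext h)
  refine Set.Finite.subset
    (Finset.finite_toSet (Finset.range n ×ˢ Finset.range n).powerset) ?_
  rintro _ ⟨μ, hμ, rfl⟩
  exact Finset.mem_coe.2 (Finset.mem_powerset.2 (YoungDiagram.cells_subset_of_card_le hμ))

theorem corePairs_finite (t n : ℕ) : (corePairs t n).Finite := by
  refine Set.Finite.subset
    ((YoungDiagram.finite_card_le n).prod (YoungDiagram.finite_card_le n)) ?_
  rintro ⟨μ, ν⟩ ⟨h, -, -⟩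
  have h' : μ.card + ν.card = n := h
  constructor
  · change μ.card ≤ n
    omega
  · change ν.card ≤ n
    omega

/-! ### Divisor sums of completely multiplicative functions -/

/-! Everything follows from 3·A_3(n) = σ(3n+2), with σ the sum of divisors
(`three_mul_numCorePairs`). For P ≡ 1 mod 3 the argument Pn + (2P-2)/3 corresponds to σ(P(3n+2)), so
both claims are instances of the solved recursion for σ(p^k N), `sum_divisors_prime_pow_mul`.

The identity for A_3 has three ingredients. Cores: a partition is determined by its first-column
hook lengths, and it is a 3-core iff this set is closed under subtracting 3
(`YoungDiagram.isCore_iff`). As 0 is excluded, such a set is given by two run lengths a, b, and the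
size is a² + b² + b - ab. Quadratic form: three times this size plus 1 is a value of x² + xy + y²,
and each orbit of the six units contains exactly one point coming from a pair (a, b). With χ the
nontrivial character mod 3, the form represents M, prime to 3, in 6·∑_{d∣M} χ(d) ways, so there are
∑_{d∣3n+1} χ(d) 3-cores of n (`ncard_natPairs_eq`). Convolution: A_3(n) is thus a convolution of
such divisor sums, evaluated by Liouville's elementary identity for the indicator of the multiples
of 3 (`three_mul_sum_antidiagonal_chiThree`). -/

theorem sum_divisors_prime_mul {R : Type*} [CommRing R] {h : ℕ → R}
    (hmul : ∀ a b, h (a * b) = h a * h b) {p : ℕ} (hp : p.Prime) {M : ℕ} (hM : M ≠ 0) :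
    ∑ d ∈ (p * M).divisors, h d =
      (1 + h p) * ∑ d ∈ M.divisors, h d - ∑ d ∈ M.divisors with p ∣ d, h d := by
  have key : (p * M).divisors = M.divisors.filter (fun d => ¬ p ∣ d) ∪
      M.divisors.image (p * ·) := by
    ext d
    simp only [Nat.mem_divisors, Finset.mem_union, Finset.mem_filter, Finset.mem_image]
    constructor
    · rintro ⟨hd, -⟩
      by_cases hpd : p ∣ d
      · obtain ⟨e, rfl⟩ := hpd
        exact Or.inr ⟨e, ⟨Nat.dvd_of_mul_dvd_mul_left hp.pos hd, hM⟩, rfl⟩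
      · exact Or.inl ⟨⟨((Nat.Prime.coprime_iff_not_dvd hp).2 hpd).symm.dvd_of_dvd_mul_left hd,
          hM⟩, hpd⟩
    · rintro (⟨⟨hd, -⟩, -⟩ | ⟨e, ⟨he, -⟩, rfl⟩)
      · exact ⟨Dvd.dvd.mul_left hd p, mul_ne_zero hp.ne_zero hM⟩
      · exact ⟨Nat.mul_dvd_mul_left p he, mul_ne_zero hp.ne_zero hM⟩
  have hdisj : Disjoint (M.divisors.filter (fun d => ¬ p ∣ d)) (M.divisors.image (p * ·)) := by
    rw [Finset.disjoint_left]
    rintro d hd hd'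
    obtain ⟨e, -, rfl⟩ := Finset.mem_image.1 hd'
    exact (Finset.mem_filter.1 hd).2 (Dvd.intro _ rfl)
  rw [key, Finset.sum_union hdisj, Finset.sum_image
    (fun a _ b _ hab => Nat.eq_of_mul_eq_mul_left hp.pos hab)]
  have := Finset.sum_filter_add_sum_filter_not M.divisors (fun d => p ∣ d) h
  simp only [hmul, ← Finset.mul_sum]
  rw [← this]
  ring

theorem sum_divisors_prime_mul_of_not_dvd {R : Type*} [CommRing R] {h : ℕ → R}
    (hmul : ∀ a b, h (a * b) = h a * h b) {p : ℕ} (hp : p.Prime) {M : ℕ} (hM : ¬ p ∣ M) :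
    ∑ d ∈ (p * M).divisors, h d = (1 + h p) * ∑ d ∈ M.divisors, h d := by
  have hM0 : M ≠ 0 := by rintro rfl; simp at hM
  rw [sum_divisors_prime_mul hmul hp hM0, Finset.filter_false_of_mem, Finset.sum_empty, sub_zero]
  exact fun d hd hpd => hM (hpd.trans (Nat.dvd_of_mem_divisors hd))

/-- The divisors of pM that are multiples of p are p times those of M. The recursion therefore needs
no coprimality of p and M. -/
theorem sum_divisors_prime_mul_mul {R : Type*} [CommRing R] {h : ℕ → R}
    (hmul : ∀ a b, h (a * b) = h a * h b) {p : ℕ} (hp : p.Prime) {M : ℕ} (hM : M ≠ 0) :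
    ∑ d ∈ (p * (p * M)).divisors, h d =
      (1 + h p) * ∑ d ∈ (p * M).divisors, h d - h p * ∑ d ∈ M.divisors, h d := by
  rw [sum_divisors_prime_mul hmul hp (mul_ne_zero hp.ne_zero hM)]
  congr 1
  have key : (p * M).divisors.filter (fun d => p ∣ d) = M.divisors.image (p * ·) := by
    ext d
    simp only [Nat.mem_divisors, Finset.mem_filter, Finset.mem_image]
    constructor
    · rintro ⟨⟨hd, -⟩, e, rfl⟩
      exact ⟨e, ⟨Nat.dvd_of_mul_dvd_mul_left hp.pos hd, hM⟩, rfl⟩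
    · rintro ⟨e, ⟨he, -⟩, rfl⟩
      exact ⟨⟨Nat.mul_dvd_mul_left p he, mul_ne_zero hp.ne_zero hM⟩, Dvd.intro _ rfl⟩
  rw [key, Finset.sum_image (fun a _ b _ hab => Nat.eq_of_mul_eq_mul_left hp.pos hab)]
  simp only [hmul, Finset.mul_sum]

/-- The recursion in k has characteristic roots 1 and p; the solution is fitted to its values at k =
0 and k = 1. -/
theorem sum_divisors_prime_pow_mul {p : ℕ} (hp : p.Prime) {N : ℕ} (hN : N ≠ 0) (k : ℕ) :
    ((p : ℚ) - 1) * ∑ d ∈ (p ^ k * N).divisors, (d : ℚ) =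
      ((p : ℚ) ^ k - 1) * ∑ d ∈ (p * N).divisors, (d : ℚ) -
        ((p : ℚ) ^ k - p) * ∑ d ∈ N.divisors, (d : ℚ) := by
  induction k using Nat.twoStepInduction with
  | zero => simp; ring
  | one => simp
  | more k ih1 ih2 =>
    have := sum_divisors_prime_mul_mul (R := ℚ) (h := fun d => (d : ℚ))
      (fun a b => Nat.cast_mul a b) hp (M := p ^ k * N) (mul_ne_zero (pow_ne_zero _ hp.ne_zero) hN)
    rw [show p ^ (k + 2) * N = p * (p * (p ^ k * N)) by ring, this,
      show p * (p ^ k * N) = p ^ (k + 1) * N by ring]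
    linear_combination (1 + (p : ℚ)) * ih2 - (p : ℚ) * ih1

/-! ### The nontrivial character modulo three -/

/-- The nontrivial Dirichlet character modulo `3`. -/
def chiThree (n : ℕ) : ℤ := if n % 3 = 1 then 1 else if n % 3 = 2 then -1 else 0

theorem chiThree_mul (a b : ℕ) : chiThree (a * b) = chiThree a * chiThree b := by
  unfold chiThree
  rw [Nat.mul_mod]
  have ha : a % 3 < 3 := Nat.mod_lt _ (by norm_num)
  have hb : b % 3 < 3 := Nat.mod_lt _ (by norm_num)
  generalize a % 3 = u at *
  generalize b % 3 = v at *
  interval_cases u <;> interval_cases v <;> simp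

theorem chiThree_of_mod_one {n : ℕ} (h : n % 3 = 1) : chiThree n = 1 := by simp [chiThree, h]

theorem chiThree_of_mod_two {n : ℕ} (h : n % 3 = 2) : chiThree n = -1 := by simp [chiThree, h]

/-- Since χ(d)χ(N/d) = χ(N) = -1, the involution d ↦ N/d flips every sign. -/
theorem sum_divisors_chiThree_of_mod_two {N : ℕ} (hN : N % 3 = 2) :
    ∑ d ∈ N.divisors, chiThree d = 0 := by
  have h : ∑ d ∈ N.divisors, chiThree (N / d) = ∑ d ∈ N.divisors, chiThree d :=
    Nat.sum_div_divisors N chiThree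
  have h2 : ∑ d ∈ N.divisors, chiThree (N / d) = - ∑ d ∈ N.divisors, chiThree d := by
    rw [← Finset.sum_neg_distrib]
    refine Finset.sum_congr rfl fun d hd => ?_
    have h3 := chiThree_mul d (N / d)
    rw [Nat.mul_div_cancel' (Nat.dvd_of_mem_divisors hd), chiThree_of_mod_two hN] at h3
    rcases Int.eq_one_or_neg_one_of_mul_eq_neg_one h3.symm with h4 | h4 <;>
      rw [h4] at h3 ⊢ <;> linarith
  omega

/-! ### Liouville's identity -/

/-- The quadruples `(a, x, b, y)` of positive integers with `a * x + b * y = N`. -/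
def mulAddQuads (N : ℕ) : Finset (ℕ × ℕ × ℕ × ℕ) :=
  (Finset.Icc 1 N ×ˢ Finset.Icc 1 N ×ˢ Finset.Icc 1 N ×ˢ Finset.Icc 1 N).filter
    fun t => t.1 * t.2.1 + t.2.2.1 * t.2.2.2 = N

theorem mem_mulAddQuads {N a x b y : ℕ} :
    (a, x, b, y) ∈ mulAddQuads N ↔ 0 < a ∧ 0 < x ∧ 0 < b ∧ 0 < y ∧ a * x + b * y = N := by
  simp only [mulAddQuads, Finset.mem_filter, Finset.mem_product, Finset.mem_Icc]
  constructor
  · rintro ⟨⟨h1, h2, h3, h4⟩, h⟩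
    exact ⟨h1.1, h2.1, h3.1, h4.1, h⟩
  · rintro ⟨h1, h2, h3, h4, h⟩
    have k1 : a ≤ a * x := Nat.le_mul_of_pos_right _ h2
    have k2 : x ≤ a * x := Nat.le_mul_of_pos_left _ h1
    have k3 : b ≤ b * y := Nat.le_mul_of_pos_right _ h4
    have k4 : y ≤ b * y := Nat.le_mul_of_pos_left _ h3
    refine ⟨⟨⟨h1, ?_⟩, ⟨h2, ?_⟩, ⟨h3, ?_⟩, ⟨h4, ?_⟩⟩, h⟩ <;> omega

theorem sum_mulAddQuads_trichotomy (N : ℕ) (u v : ℕ × ℕ × ℕ × ℕ → ℕ) (f : ℕ × ℕ × ℕ × ℕ → ℤ) :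
    ∑ t ∈ mulAddQuads N, f t = ∑ t ∈ mulAddQuads N with u t = v t, f t +
      ∑ t ∈ mulAddQuads N with v t < u t, f t + ∑ t ∈ mulAddQuads N with u t < v t, f t := by
  simp only [Finset.sum_filter, ← Finset.sum_add_distrib]
  refine Finset.sum_congr rfl fun t _ => ?_
  rcases lt_trichotomy (u t) (v t) with h | h | h
  · simp [h, h.ne, h.not_gt]
  · simp [h]
  · simp [h, h.ne', h.not_gt]

theorem sum_mulAddQuads_swap (N : ℕ) (P : ℕ → ℕ → ℕ → ℕ → Prop)
    [∀ a x b y, Decidable (P a x b y)] (f : ℕ → ℕ → ℕ → ℕ → ℤ) :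
    ∑ t ∈ mulAddQuads N with P t.1 t.2.1 t.2.2.1 t.2.2.2, f t.1 t.2.1 t.2.2.1 t.2.2.2 =
      ∑ t ∈ mulAddQuads N with P t.2.2.1 t.2.2.2 t.1 t.2.1, f t.2.2.1 t.2.2.2 t.1 t.2.1 := by
  refine Finset.sum_nbij' (fun t => (t.2.2.1, t.2.2.2, t.1, t.2.1))
    (fun t => (t.2.2.1, t.2.2.2, t.1, t.2.1)) ?_ ?_ (fun _ _ => rfl) (fun _ _ => rfl)
    (fun _ _ => rfl) <;>
  · rintro ⟨a, x, b, y⟩ h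
    simp only [Finset.mem_filter, mem_mulAddQuads] at h ⊢
    obtain ⟨⟨h1, h2, h3, h4, h5⟩, h6⟩ := h
    exact ⟨⟨h3, h4, h1, h2, by omega⟩, h6⟩

/-- Rests on ax + by = (a-b)x + b(x+y). -/
theorem sum_mulAddQuads_sub (N : ℕ) (F : ℤ → ℤ) :
    ∑ t ∈ mulAddQuads N with t.2.2.1 < t.1, F ((t.1 : ℤ) - t.2.2.1) =
      ∑ t ∈ mulAddQuads N with t.2.1 < t.2.2.2, F t.1 := by
  refine Finset.sum_nbij' (fun t => (t.1 - t.2.2.1, t.2.1, t.2.2.1, t.2.1 + t.2.2.2))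
    (fun t => (t.1 + t.2.2.1, t.2.1, t.2.2.1, t.2.2.2 - t.2.1)) ?_ ?_ ?_ ?_ ?_
  · rintro ⟨a, x, b, y⟩ h
    simp only [Finset.mem_filter, mem_mulAddQuads] at h ⊢
    obtain ⟨⟨h1, h2, h3, h4, h5⟩, h6⟩ := h
    obtain ⟨c, rfl⟩ := Nat.exists_eq_add_of_lt h6
    refine ⟨⟨by omega, h2, h3, by omega, ?_⟩, by omega⟩
    rw [← h5, show b + c + 1 - b = c + 1 by omega]
    ring
  · rintro ⟨a, x, b, y⟩ h
    simp only [Finset.mem_filter, mem_mulAddQuads] at h ⊢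
    obtain ⟨⟨h1, h2, h3, h4, h5⟩, h6⟩ := h
    obtain ⟨c, rfl⟩ := Nat.exists_eq_add_of_lt h6
    refine ⟨⟨by omega, h2, h3, by omega, ?_⟩, by omega⟩
    rw [← h5, show x + c + 1 - x = c + 1 by omega]
    ring
  · rintro ⟨a, x, b, y⟩ h
    simp only [Finset.mem_filter] at h
    simp only [Prod.mk.injEq, true_and]
    omega
  · rintro ⟨a, x, b, y⟩ h
    simp only [Finset.mem_filter] at h
    simp only [Prod.mk.injEq, true_and]
    omega
  · rintro ⟨a, x, b, y⟩ h
    simp only [Finset.mem_filter] at h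
    simp only
    congr 1
    omega

/-- Rests on ax + by = (a+b)y + a(x-y). -/
theorem sum_mulAddQuads_add (N : ℕ) (F : ℤ → ℤ) :
    ∑ t ∈ mulAddQuads N with t.2.2.2 < t.2.1, F ((t.1 : ℤ) + t.2.2.1) =
      ∑ t ∈ mulAddQuads N with t.2.2.1 < t.1, F t.1 := by
  refine Finset.sum_nbij' (fun t => (t.1 + t.2.2.1, t.2.2.2, t.1, t.2.1 - t.2.2.2))
    (fun t => (t.2.2.1, t.2.1 + t.2.2.2, t.1 - t.2.2.1, t.2.1)) ?_ ?_ ?_ ?_ ?_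
  · rintro ⟨a, x, b, y⟩ h
    simp only [Finset.mem_filter, mem_mulAddQuads] at h ⊢
    obtain ⟨⟨h1, h2, h3, h4, h5⟩, h6⟩ := h
    obtain ⟨c, rfl⟩ := Nat.exists_eq_add_of_lt h6
    refine ⟨⟨by omega, h4, h1, by omega, ?_⟩, by omega⟩
    rw [← h5, show y + c + 1 - y = c + 1 by omega]
    ring
  · rintro ⟨a, x, b, y⟩ h
    simp only [Finset.mem_filter, mem_mulAddQuads] at h ⊢
    obtain ⟨⟨h1, h2, h3, h4, h5⟩, h6⟩ := h
    obtain ⟨c, rfl⟩ := Nat.exists_eq_add_of_lt h6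
    refine ⟨⟨h3, by omega, by omega, h2, ?_⟩, by omega⟩
    rw [← h5, show b + c + 1 - b = c + 1 by omega]
    ring
  · rintro ⟨a, x, b, y⟩ h
    simp only [Finset.mem_filter] at h
    simp only [Prod.mk.injEq, true_and, and_true]
    omega
  · rintro ⟨a, x, b, y⟩ h
    simp only [Finset.mem_filter] at h
    simp only [Prod.mk.injEq, true_and]
    omega
  · rintro ⟨a, x, b, y⟩ h
    simp only [Finset.mem_filter] at h
    simp only
    congr 1

/-- Rests on ax + by = a(x-y) + (a+b)y. -/
theorem sum_mulAddQuads_shear (N : ℕ) (F : ℤ → ℤ) :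
    ∑ t ∈ mulAddQuads N with t.2.2.2 < t.2.1, F t.1 =
      ∑ t ∈ mulAddQuads N with t.1 < t.2.2.1, F t.1 := by
  refine Finset.sum_nbij' (fun t => (t.1, t.2.1 - t.2.2.2, t.1 + t.2.2.1, t.2.2.2))
    (fun t => (t.1, t.2.1 + t.2.2.2, t.2.2.1 - t.1, t.2.2.2)) ?_ ?_ ?_ ?_ ?_
  · rintro ⟨a, x, b, y⟩ h
    simp only [Finset.mem_filter, mem_mulAddQuads] at h ⊢
    obtain ⟨⟨h1, h2, h3, h4, h5⟩, h6⟩ := h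
    obtain ⟨c, rfl⟩ := Nat.exists_eq_add_of_lt h6
    refine ⟨⟨h1, by omega, by omega, h4, ?_⟩, by omega⟩
    rw [← h5, show y + c + 1 - y = c + 1 by omega]
    ring
  · rintro ⟨a, x, b, y⟩ h
    simp only [Finset.mem_filter, mem_mulAddQuads] at h ⊢
    obtain ⟨⟨h1, h2, h3, h4, h5⟩, h6⟩ := h
    obtain ⟨c, rfl⟩ := Nat.exists_eq_add_of_lt h6
    refine ⟨⟨h1, by omega, by omega, h4, ?_⟩, by omega⟩
    rw [← h5, show a + c + 1 - a = c + 1 by omega]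
    ring
  · rintro ⟨a, x, b, y⟩ h
    simp only [Finset.mem_filter] at h
    simp only [Prod.mk.injEq, true_and, and_true]
    omega
  · rintro ⟨a, x, b, y⟩ h
    simp only [Finset.mem_filter] at h
    simp only [Prod.mk.injEq, true_and, and_true]
    omega
  · rintro ⟨a, x, b, y⟩ h
    rfl

/-- Off the diagonals, the swap symmetry and the first two bijections turn the left side into
2∑_{x<y} F(a) - 2∑_{b<a} F(a). Replacing each sum by its complement, the parts y < x and a < b
cancel by the shear, and only diagonal terms survive. -/
theorem liouville_identity (N : ℕ) (F : ℤ → ℤ) (hF : ∀ z, F (-z) = F z) :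
    ∑ t ∈ mulAddQuads N, (F ((t.1 : ℤ) - t.2.2.1) - F ((t.1 : ℤ) + t.2.2.1)) =
      ∑ t ∈ mulAddQuads N with t.1 = t.2.2.1, (F 0 + 2 * F t.1) -
        ∑ t ∈ mulAddQuads N with t.2.1 = t.2.2.2, (F ((t.1 : ℤ) + t.2.2.1) + 2 * F t.1) := by
  have e1 := sum_mulAddQuads_trichotomy N (fun t => t.1) (fun t => t.2.2.1)
    (fun t => F ((t.1 : ℤ) - t.2.2.1))
  have e2 := sum_mulAddQuads_trichotomy N (fun t => t.2.1) (fun t => t.2.2.2)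
    (fun t => F ((t.1 : ℤ) + t.2.2.1))
  have e3 := sum_mulAddQuads_trichotomy N (fun t => t.1) (fun t => t.2.2.1) (fun t => F t.1)
  have e4 := sum_mulAddQuads_trichotomy N (fun t => t.2.1) (fun t => t.2.2.2) (fun t => F t.1)
  have s1 := sum_mulAddQuads_swap N (fun a _ b _ => a < b) (fun a _ b _ => F ((a : ℤ) - b))
  have s2 := sum_mulAddQuads_swap N (fun _ x _ y => x < y) (fun a _ b _ => F ((a : ℤ) + b))
  have s1' : ∑ t ∈ mulAddQuads N with t.2.2.1 < t.1, F ((t.2.2.1 : ℤ) - t.1) =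
      ∑ t ∈ mulAddQuads N with t.2.2.1 < t.1, F ((t.1 : ℤ) - t.2.2.1) :=
    Finset.sum_congr rfl fun t _ => by rw [← hF, neg_sub]
  have s2' : ∑ t ∈ mulAddQuads N with t.2.2.2 < t.2.1, F ((t.2.2.1 : ℤ) + t.1) =
      ∑ t ∈ mulAddQuads N with t.2.2.2 < t.2.1, F ((t.1 : ℤ) + t.2.2.1) :=
    Finset.sum_congr rfl fun t _ => by rw [add_comm]
  have z1 : ∑ t ∈ mulAddQuads N with t.1 = t.2.2.1, F ((t.1 : ℤ) - t.2.2.1) =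
      ∑ t ∈ mulAddQuads N with t.1 = t.2.2.1, F 0 :=
    Finset.sum_congr rfl fun t ht => by rw [(Finset.mem_filter.1 ht).2, sub_self]
  have b1 := sum_mulAddQuads_sub N F
  have b2 := sum_mulAddQuads_add N F
  have b3 := sum_mulAddQuads_shear N F
  simp only [Finset.sum_sub_distrib, Finset.sum_add_distrib, ← Finset.mul_sum]
  linarith

theorem sum_mulAddQuads_eq_sum_antidiagonal (N : ℕ) (f : ℕ → ℤ) :
    ∑ t ∈ mulAddQuads N, f t.1 * f t.2.2.1 =
      ∑ q ∈ Finset.HasAntidiagonal.antidiagonal N, (∑ d ∈ q.1.divisors, f d) * ∑ d ∈ q.2.divisors, f d := by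
  have h : ∀ q : ℕ × ℕ, (∑ d ∈ q.1.divisors, f d) * ∑ d ∈ q.2.divisors, f d =
      ∑ c ∈ q.1.divisors ×ˢ q.2.divisors, f c.1 * f c.2 := fun q => by
    rw [Finset.sum_mul_sum, Finset.sum_product]
  simp only [h]
  rw [Finset.sum_sigma']
  refine Finset.sum_nbij' (fun t => ⟨(t.1 * t.2.1, t.2.2.1 * t.2.2.2), (t.1, t.2.2.1)⟩)
    (fun s => (s.2.1, s.1.1 / s.2.1, s.2.2, s.1.2 / s.2.2)) ?_ ?_ ?_ ?_ (fun _ _ => rfl)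
  · rintro ⟨a, x, b, y⟩ h
    rw [mem_mulAddQuads] at h
    obtain ⟨h1, h2, h3, h4, h5⟩ := h
    simp [h5, h1.ne', h2.ne', h3.ne', h4.ne']
  · rintro ⟨⟨m, n⟩, a, b⟩ h
    simp only [Finset.mem_sigma, Finset.HasAntidiagonal.mem_antidiagonal, Finset.mem_product,
      Nat.mem_divisors] at h
    obtain ⟨rfl, ⟨⟨x, rfl⟩, hm⟩, ⟨⟨y, rfl⟩, hn⟩⟩ := h
    have ha := Nat.pos_of_ne_zero (left_ne_zero_of_mul hm)
    have hb := Nat.pos_of_ne_zero (left_ne_zero_of_mul hn)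
    simp only [mem_mulAddQuads, Nat.mul_div_cancel_left _ ha, Nat.mul_div_cancel_left _ hb]
    exact ⟨ha, Nat.pos_of_ne_zero (right_ne_zero_of_mul hm), hb,
      Nat.pos_of_ne_zero (right_ne_zero_of_mul hn), trivial⟩
  · rintro ⟨a, x, b, y⟩ h
    rw [mem_mulAddQuads] at h
    obtain ⟨h1, h2, h3, h4, h5⟩ := h
    simp [Nat.mul_div_cancel_left _ h1, Nat.mul_div_cancel_left _ h3]
  · rintro ⟨⟨m, n⟩, a, b⟩ h
    simp only [Finset.mem_sigma, Finset.HasAntidiagonal.mem_antidiagonal, Finset.mem_product,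
      Nat.mem_divisors] at h
    obtain ⟨rfl, ⟨⟨x, rfl⟩, hm⟩, ⟨⟨y, rfl⟩, hn⟩⟩ := h
    have ha := Nat.pos_of_ne_zero (left_ne_zero_of_mul hm)
    have hb := Nat.pos_of_ne_zero (left_ne_zero_of_mul hn)
    simp [Nat.mul_div_cancel_left _ ha, Nat.mul_div_cancel_left _ hb]

/-- When x = y the equation reads (a+b)x = N, so d = a+b divides N and a runs over 1, …, d-1. -/
theorem sum_mulAddQuads_snd_eq (N : ℕ) (f : ℕ → ℤ) :
    ∑ t ∈ mulAddQuads N with t.2.1 = t.2.2.2, f t.1 =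
      ∑ d ∈ N.divisors, ∑ l ∈ Finset.Ico 1 d, f l := by
  rw [Finset.sum_sigma']
  refine Finset.sum_nbij' (fun t => ⟨t.1 + t.2.2.1, t.1⟩)
    (fun s => (s.2, N / s.1, s.1 - s.2, N / s.1)) ?_ ?_ ?_ ?_ (fun _ _ => rfl)
  · rintro ⟨a, x, b, y⟩ h
    simp only [Finset.mem_filter, mem_mulAddQuads] at h
    obtain ⟨⟨h1, h2, h3, h4, h5⟩, rfl⟩ := h
    simp only [Finset.mem_sigma, Nat.mem_divisors, Finset.mem_Ico]
    have : (a + b) * x = N := by rw [← h5]; ring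
    exact ⟨⟨⟨x, this.symm⟩, by rw [← this]; positivity⟩, h1, by omega⟩
  · rintro ⟨d, l⟩ h
    simp only [Finset.mem_sigma, Nat.mem_divisors, Finset.mem_Ico] at h
    obtain ⟨⟨⟨x, rfl⟩, hN⟩, hl, hd⟩ := h
    have hx := Nat.pos_of_ne_zero (right_ne_zero_of_mul hN)
    simp only [Finset.mem_filter, mem_mulAddQuads,
      Nat.mul_div_cancel_left _ (show 0 < d by omega)]
    refine ⟨⟨hl, hx, by omega, hx, ?_⟩, trivial⟩
    rw [← add_mul, Nat.add_sub_cancel' hd.le]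
  · rintro ⟨a, x, b, y⟩ h
    simp only [Finset.mem_filter, mem_mulAddQuads] at h
    obtain ⟨⟨h1, h2, h3, h4, h5⟩, rfl⟩ := h
    have h6 : N / (a + b) = x := by
      rw [← h5, ← add_mul, Nat.mul_div_cancel_left _ (by omega)]
    simp [h6]
  · rintro ⟨d, l⟩ h
    simp only [Finset.mem_sigma, Nat.mem_divisors, Finset.mem_Ico] at h
    obtain ⟨-, hl, hd⟩ := h
    simp only [Nat.add_sub_cancel' hd.le]

theorem card_mulAddQuads_fst_eq (N : ℕ) :
    ∑ t ∈ mulAddQuads N with t.1 = t.2.2.1, (1 : ℤ) = ∑ d ∈ N.divisors, ((d : ℤ) - 1) := by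
  have h := sum_mulAddQuads_snd_eq N (fun _ => 1)
  have h2 : ∀ d ∈ N.divisors, ∑ l ∈ Finset.Ico 1 d, (1 : ℤ) = (d : ℤ) - 1 := fun d hd => by
    have := Nat.pos_of_mem_divisors hd
    simp
    omega
  rw [Finset.sum_congr rfl h2] at h
  rw [← h]
  refine Finset.sum_nbij' (fun t => (t.2.1, t.1, t.2.2.2, t.2.2.1))
    (fun t => (t.2.1, t.1, t.2.2.2, t.2.2.1)) ?_ ?_ (fun _ _ => rfl) (fun _ _ => rfl)
    (fun _ _ => rfl) <;>
  · rintro ⟨a, x, b, y⟩ h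
    simp only [Finset.mem_filter, mem_mulAddQuads] at h ⊢
    obtain ⟨⟨h1, h2, h3, h4, h5⟩, h6⟩ := h
    exact ⟨⟨h2, h1, h4, h3, by rw [← h5, mul_comm x a, mul_comm y b]⟩, h6⟩

theorem sum_Ico_three_dvd (d : ℕ) :
    ∑ l ∈ Finset.Ico 1 d, (if (3 : ℤ) ∣ l then (1 : ℤ) else 0) = ((d - 1) / 3 : ℕ) := by
  induction d with
  | zero => simp
  | succ d ih =>
    rcases Nat.eq_zero_or_pos d with rfl | hd
    · simp
    · rw [Finset.sum_Ico_succ_top hd, ih]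
      split_ifs <;> omega

/-- For F the indicator of 3 ∣ z, F(a-b) - F(a+b) = χ(a)χ(b). On the diagonals, a or a+b divides N
and is prime to 3, which kills half of the terms. -/
theorem three_mul_sum_antidiagonal_chiThree {N : ℕ} (hN : N % 3 = 2) :
    3 * ∑ q ∈ Finset.HasAntidiagonal.antidiagonal N,
      (∑ d ∈ q.1.divisors, chiThree d) * ∑ d ∈ q.2.divisors, chiThree d =
        ∑ d ∈ N.divisors, (d : ℤ) := by
  set F : ℤ → ℤ := fun z => if 3 ∣ z then 1 else 0 with hFdef
  have hL := liouville_identity N F (fun z => by simp [hFdef])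
  have hdiv : ∀ d ∈ N.divisors, d % 3 = 1 ∨ d % 3 = 2 := fun d hd => by
    obtain ⟨e, rfl⟩ := Nat.dvd_of_mem_divisors hd
    by_contra hc
    have : 3 ∣ d := by omega
    have : 3 ∣ d * e := Dvd.dvd.mul_right this e
    omega
  have h1 : ∑ t ∈ mulAddQuads N, (F ((t.1 : ℤ) - t.2.2.1) - F ((t.1 : ℤ) + t.2.2.1)) =
      ∑ t ∈ mulAddQuads N, chiThree t.1 * chiThree t.2.2.1 := by
    refine Finset.sum_congr rfl fun t _ => ?_
    simp only [hFdef, chiThree]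
    split_ifs <;> first | rfl | omega
  have h2 : ∑ t ∈ mulAddQuads N with t.1 = t.2.2.1, (F 0 + 2 * F t.1) =
      ∑ d ∈ N.divisors, ((d : ℤ) - 1) := by
    rw [← card_mulAddQuads_fst_eq]
    refine Finset.sum_congr rfl fun t ht => ?_
    obtain ⟨a, x, b, y⟩ := t
    simp only [Finset.mem_filter, mem_mulAddQuads] at ht
    obtain ⟨⟨h1, h2, h3, h4, h5⟩, rfl⟩ := ht
    have := hdiv a (Nat.mem_divisors.2 ⟨⟨x + y, by rw [← h5]; ring⟩, by omega⟩)
    have h6 : ¬ (3 : ℤ) ∣ a := by omega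
    simp [hFdef, h6]
  have h3 : ∑ t ∈ mulAddQuads N with t.2.1 = t.2.2.2, (F ((t.1 : ℤ) + t.2.2.1) + 2 * F t.1) =
      ∑ d ∈ N.divisors, 2 * (((d - 1) / 3 : ℕ) : ℤ) := by
    rw [← Finset.mul_sum, ← Finset.sum_congr rfl (fun d _ => sum_Ico_three_dvd d),
      ← sum_mulAddQuads_snd_eq N (fun l => if (3 : ℤ) ∣ l then (1 : ℤ) else 0), Finset.mul_sum]
    refine Finset.sum_congr rfl fun t ht => ?_
    obtain ⟨a, x, b, y⟩ := t
    simp only [Finset.mem_filter, mem_mulAddQuads] at ht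
    obtain ⟨⟨h1, h2, h3, h4, h5⟩, rfl⟩ := ht
    have := hdiv (a + b) (Nat.mem_divisors.2 ⟨⟨x, by rw [← h5]; ring⟩, by omega⟩)
    have h6 : ¬ (3 : ℤ) ∣ (a : ℤ) + b := by omega
    simp [hFdef, h6]
  rw [h1, h2, h3, sum_mulAddQuads_eq_sum_antidiagonal, ← Finset.sum_sub_distrib] at hL
  -- The vanishing sum of χ is inserted so that the identity holds divisor by divisor: 3(d - 1 -
  -- 2⌊(d-1)/3⌋) = d - χ(d).
  rw [hL, Finset.mul_sum, ← sub_zero (∑ d ∈ N.divisors, (d : ℤ)),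
    ← sum_divisors_chiThree_of_mod_two hN, ← Finset.sum_sub_distrib]
  refine Finset.sum_congr rfl fun d hd => ?_
  rcases hdiv d hd with h | h
  · rw [chiThree_of_mod_one h]; omega
  · rw [chiThree_of_mod_two h]; omega

theorem three_mul_sum_antidiagonal_chiThree' (n : ℕ) :
    3 * ∑ q ∈ Finset.HasAntidiagonal.antidiagonal n,
      (∑ d ∈ (3 * q.1 + 1).divisors, chiThree d) * ∑ d ∈ (3 * q.2 + 1).divisors, chiThree d =
        ∑ d ∈ (3 * n + 2).divisors, (d : ℤ) := by
  rw [← three_mul_sum_antidiagonal_chiThree (N := 3 * n + 2) (by omega)]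
  congr 1
  -- The two entries add up to 2 mod 3, so unless both are 1 mod 3 one of them is 2 mod 3 and its
  -- divisor sum vanishes.
  have hz : ∀ q ∈ Finset.HasAntidiagonal.antidiagonal (3 * n + 2), (∑ d ∈ q.1.divisors, chiThree d) *
      ∑ d ∈ q.2.divisors, chiThree d ≠ 0 → q.1 % 3 = 1 := by
    intro q hq h
    rw [Finset.HasAntidiagonal.mem_antidiagonal] at hq
    have h1 : ¬ q.1 % 3 = 2 := fun h1 => by simp [sum_divisors_chiThree_of_mod_two h1] at h
    have h2 : ¬ q.2 % 3 = 2 := fun h2 => by simp [sum_divisors_chiThree_of_mod_two h2] at h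
    omega
  rw [← Finset.sum_filter_of_ne hz]
  refine Finset.sum_nbij' (fun q => (3 * q.1 + 1, 3 * q.2 + 1)) (fun q => (q.1 / 3, q.2 / 3))
    ?_ ?_ ?_ ?_ (fun _ _ => rfl)
  · rintro ⟨i, j⟩ h
    simp only [Finset.mem_filter, Finset.HasAntidiagonal.mem_antidiagonal] at h ⊢
    omega
  · rintro ⟨i, j⟩ h
    simp only [Finset.mem_filter, Finset.HasAntidiagonal.mem_antidiagonal] at h ⊢
    omega
  · rintro ⟨i, j⟩ h
    simp only [Prod.mk.injEq]
    omega
  · rintro ⟨i, j⟩ h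
    simp only [Finset.mem_filter, Finset.HasAntidiagonal.mem_antidiagonal] at h
    simp only [Prod.mk.injEq]
    omega

/-! ### Representations by the form `x ^ 2 + x * y + y ^ 2` -/

/-- The representations of `M` by the binary quadratic form `x ^ 2 + x * y + y ^ 2`. -/
def eisensteinReps (M : ℕ) : Set (ℤ × ℤ) := {z | z.1 ^ 2 + z.1 * z.2 + z.2 ^ 2 = M}

theorem mem_eisensteinReps {M : ℕ} {x y : ℤ} :
    (x, y) ∈ eisensteinReps M ↔ x ^ 2 + x * y + y ^ 2 = M := Iff.rfl

theorem eisensteinReps_subset (M : ℕ) :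
    eisensteinReps M ⊆ ↑(Finset.Icc (-(2 * M : ℤ)) (2 * M) ×ˢ Finset.Icc (-(2 * M : ℤ)) (2 * M)) := by
  rintro ⟨x, y⟩ h
  rw [mem_eisensteinReps] at h
  have hx : x ^ 2 ≤ 2 * M := by nlinarith [sq_nonneg (2 * y + x), sq_nonneg x]
  have hy : y ^ 2 ≤ 2 * M := by nlinarith [sq_nonneg (2 * x + y), sq_nonneg y]
  simp only [Finset.coe_product, Finset.coe_Icc, Set.mem_prod, Set.mem_Icc]
  have key : ∀ t : ℤ, t ^ 2 ≤ 2 * M → -(2 * M : ℤ) ≤ t ∧ t ≤ 2 * M := fun t ht => by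
    have h1 := Int.le_self_sq t
    have h2 := Int.le_self_sq (-t)
    constructor <;> nlinarith
  exact ⟨key x hx, key y hy⟩

theorem eisensteinReps_finite (M : ℕ) : (eisensteinReps M).Finite :=
  (Finset.finite_toSet _).subset (eisensteinReps_subset M)

theorem ncard_eisensteinReps_one : (eisensteinReps 1).ncard = 6 := by
  have : eisensteinReps 1 = ↑((Finset.Icc (-2 : ℤ) 2 ×ˢ Finset.Icc (-2 : ℤ) 2).filter
      fun z => z.1 ^ 2 + z.1 * z.2 + z.2 ^ 2 = 1) := by
    ext z
    rw [Finset.coe_filter]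
    exact ⟨fun h => ⟨by simpa [Prod.le_def, and_and_and_comm] using eisensteinReps_subset 1 h, by simpa [eisensteinReps] using h⟩,
      fun h => by simpa [eisensteinReps] using h.2⟩
  rw [this, Set.ncard_coe_finset]
  decide

theorem Set.ncard_eq_of_mem_iff {α β : Type*} (e : α ≃ β) {A : Set α} {B : Set β}
    (h : ∀ z, z ∈ A ↔ e z ∈ B) : A.ncard = B.ncard := by
  have : e '' A = B := by
    ext w
    rw [Set.mem_image]
    constructor
    · rintro ⟨z, hz, rfl⟩
      exact (h z).1 hz
    · intro hw
      exact ⟨e.symm w, (h _).2 (by simpa using hw), by simp⟩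
  rw [← this, Set.ncard_image_of_injective _ e.injective]

/-- Otherwise t = x/y satisfies t² + t + 1 = 0, so its order divides both 3 and p-1; hence t = 1 and
p = 3. -/
theorem prime_dvd_of_dvd_eisenstein {p : ℕ} (hp : p.Prime) (h3 : p % 3 = 2) {x y : ℤ}
    (h : (p : ℤ) ∣ x ^ 2 + x * y + y ^ 2) : (p : ℤ) ∣ x ∧ (p : ℤ) ∣ y := by
  have := Fact.mk hp
  have h' : (x : ZMod p) ^ 2 + x * y + (y : ZMod p) ^ 2 = 0 := by
    have := (ZMod.intCast_zmod_eq_zero_iff_dvd _ p).2 h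
    push_cast at this
    exact this
  have hy : (y : ZMod p) = 0 := by
    by_contra hy
    set t : ZMod p := x / y with ht
    have hx : (x : ZMod p) = t * y := by rw [ht, div_mul_cancel₀ _ hy]
    have h1 : t ^ 2 + t + 1 = 0 := by
      have : (t ^ 2 + t + 1) * (y : ZMod p) ^ 2 = 0 := by
        rw [← h', hx]; ring
      exact (mul_eq_zero.1 this).resolve_right (pow_ne_zero _ hy)
    have h2 : t ^ 3 = 1 := by linear_combination (t - 1) * h1
    have ht0 : t ≠ 0 := by rintro h0; rw [h0] at h2; simp at h2
    have h4 : orderOf t ∣ 3 := orderOf_dvd_of_pow_eq_one h2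
    have h5 : orderOf t ∣ p - 1 := orderOf_dvd_of_pow_eq_one (ZMod.pow_card_sub_one_eq_one ht0)
    have h6 : orderOf t = 1 := by
      rcases (Nat.dvd_prime Nat.prime_three).1 h4 with h6 | h6
      · exact h6
      · rw [h6] at h5
        have := hp.two_le
        omega
    have h7 : t = 1 := orderOf_eq_one_iff.1 h6
    rw [h7] at h1
    have h8 : ((3 : ℕ) : ZMod p) = 0 := by push_cast; linear_combination h1
    rw [ZMod.natCast_eq_zero_iff] at h8
    have := (Nat.prime_dvd_prime_iff_eq hp Nat.prime_three).1 h8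
    omega
  have hx : (x : ZMod p) = 0 := by
    rw [hy] at h'
    simpa using h'
  exact ⟨(ZMod.intCast_zmod_eq_zero_iff_dvd _ p).1 hx, (ZMod.intCast_zmod_eq_zero_iff_dvd _ p).1 hy⟩

theorem exists_sq_add_self_add_one_eq_zero {p : ℕ} (hp : p.Prime) (h3 : p % 3 = 1) :
    ∃ c : ZMod p, c ^ 2 + c + 1 = 0 := by
  have := Fact.mk hp
  have hd : 3 ∣ Fintype.card (ZMod p)ˣ := by
    rw [ZMod.card_units]
    omega
  have := Fact.mk Nat.prime_three
  obtain ⟨u, hu⟩ := exists_prime_orderOf_dvd_card 3 hd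
  refine ⟨u, ?_⟩
  have h1 : (u : ZMod p) ^ 3 = 1 := by
    rw [← Units.val_pow_eq_pow_val, ← hu, pow_orderOf_eq_one, Units.val_one]
  have h2 : (u : ZMod p) ≠ 1 := by
    intro h
    have : u = 1 := Units.ext h
    rw [this, orderOf_one] at hu
    omega
  have h4 : ((u : ZMod p) - 1) * ((u : ZMod p) ^ 2 + u + 1) = 0 := by linear_combination h1
  exact (mul_eq_zero.1 h4).resolve_left (sub_ne_zero.2 h2)

/-- Thue's argument: pigeonhole on i - cj with 0 ≤ i, j ≤ √p gives small u ≡ cv, and the form at (u,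
v) is a multiple of p strictly between 0 and 3p. The value 2p is impossible because 2 is inert. -/
theorem exists_eisenstein_eq_prime {p : ℕ} (hp : p.Prime) (h3 : p % 3 = 1) :
    ∃ a b : ℤ, a ^ 2 + a * b + b ^ 2 = p := by
  have := Fact.mk hp
  obtain ⟨c, hc⟩ := exists_sq_add_self_add_one_eq_zero hp h3
  set s := p.sqrt with hs
  have hs1 : s * s ≤ p := Nat.sqrt_le p
  have hs2 : p < (s + 1) * (s + 1) := Nat.lt_succ_sqrt p
  have hs3 : s * s ≠ p := fun h => hp.prime.not_isSquare ⟨s, h.symm⟩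
  have hcard : (Finset.univ : Finset (ZMod p)).card <
      (Finset.range (s + 1) ×ˢ Finset.range (s + 1)).card := by
    rw [Finset.card_univ, ZMod.card, Finset.card_product, Finset.card_range]
    exact hs2
  obtain ⟨⟨i, j⟩, h1, ⟨i', j'⟩, h2, hne, heq⟩ := Finset.exists_ne_map_eq_of_card_lt_of_maps_to hcard
    (f := fun q => (q.1 : ZMod p) - c * q.2) (fun _ _ => Finset.mem_univ _)
  simp only [Finset.mem_product, Finset.mem_range] at h1 h2
  obtain ⟨u, hu⟩ : ∃ u : ℤ, u = i - i' := ⟨_, rfl⟩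
  obtain ⟨v, hv⟩ : ∃ v : ℤ, v = j - j' := ⟨_, rfl⟩
  have huv : (u : ZMod p) = c * v := by
    rw [hu, hv]
    push_cast
    simp only at heq
    linear_combination heq
  have hdvd : (p : ℤ) ∣ u ^ 2 + u * v + v ^ 2 := by
    rw [← ZMod.intCast_zmod_eq_zero_iff_dvd]
    push_cast
    rw [huv]
    linear_combination (v : ZMod p) ^ 2 * hc
  have hne0 : u ≠ 0 ∨ v ≠ 0 := by
    by_contra hcon
    push Not at hcon
    apply hne
    simp only [Prod.mk.injEq]
    omega
  have hpos : 0 < u ^ 2 + u * v + v ^ 2 := by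
    rcases hne0 with h | h
    · nlinarith [sq_nonneg (2 * v + u), sq_pos_of_ne_zero h]
    · nlinarith [sq_nonneg (2 * u + v), sq_pos_of_ne_zero h]
  have hus : u ^ 2 ≤ (s : ℤ) ^ 2 := sq_le_sq' (by omega) (by omega)
  have hvs : v ^ 2 ≤ (s : ℤ) ^ 2 := sq_le_sq' (by omega) (by omega)
  have hsp : (s : ℤ) ^ 2 < p := by
    have : s * s < p := lt_of_le_of_ne hs1 hs3
    rw [sq]
    exact_mod_cast this
  have hlt : u ^ 2 + u * v + v ^ 2 < 3 * p := by nlinarith [sq_nonneg (u - v)]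
  obtain ⟨m, hm⟩ := hdvd
  have hp0 : (0 : ℤ) < p := by exact_mod_cast hp.pos
  have hm1 : 0 < m := by
    by_contra hcon
    nlinarith
  have hm3 : m < 3 := by
    by_contra hcon
    nlinarith
  have hm12 : m = 1 ∨ m = 2 := by omega
  rcases hm12 with rfl | rfl
  · exact ⟨u, v, by linarith⟩
  · exfalso
    have h2 : ((2 : ℕ) : ℤ) ∣ u ^ 2 + u * v + v ^ 2 := ⟨p, by rw [hm]; push_cast; ring⟩
    obtain ⟨⟨u', rfl⟩, ⟨v', rfl⟩⟩ := prime_dvd_of_dvd_eisenstein Nat.prime_two (by norm_num) h2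
    have h4 : (p : ℤ) = 2 * (u' ^ 2 + u' * v' + v' ^ 2) := by push_cast at hm; linarith
    have h5 : 2 ∣ p := by
      have : ((2 : ℕ) : ℤ) ∣ p := ⟨_, by rw [h4]; rfl⟩
      exact_mod_cast this
    have := (Nat.prime_dvd_prime_iff_eq Nat.prime_two hp).1 h5
    omega

theorem not_dvd_of_eisenstein_eq_prime {p : ℕ} (hp : p.Prime) {a b : ℤ}
    (hab : a ^ 2 + a * b + b ^ 2 = p) : ¬ (p : ℤ) ∣ b := by
  have hpZ : Prime (p : ℤ) := Nat.prime_iff_prime_int.1 hp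
  rintro ⟨b', rfl⟩
  have h1 : (p : ℤ) ∣ a ^ 2 := ⟨1 - a * b' - p * b' ^ 2, by linear_combination hab⟩
  obtain ⟨a', rfl⟩ := hpZ.dvd_of_dvd_pow h1
  have h2 : (p : ℤ) * (p * (a' ^ 2 + a' * b' + b' ^ 2)) = p * 1 := by linear_combination hab
  exact hpZ.not_dvd_one ⟨_, (mul_left_cancel₀ hpZ.ne_zero h2).symm⟩

/-- The form is the norm of x + yζ with ζ² = ζ - 1, and the map is multiplication by π = a + bζ. The
divisibility condition says that π divides z: up to sign, bX - aY is the ζ-coordinate of z times the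
conjugate of π. -/
theorem ncard_eisensteinReps_mul_dvd {p : ℕ} (hp : p.Prime) {a b : ℤ}
    (hab : a ^ 2 + a * b + b ^ 2 = p) (M : ℕ) :
    {z ∈ eisensteinReps (p * M) | (p : ℤ) ∣ b * z.1 - a * z.2}.ncard =
      (eisensteinReps M).ncard := by
  have hpZ : Prime (p : ℤ) := Nat.prime_iff_prime_int.1 hp
  have hp0 : (p : ℤ) ≠ 0 := hpZ.ne_zero
  have hb := not_dvd_of_eisenstein_eq_prime hp hab
  symm
  refine Set.ncard_congr (fun z _ => (z.1 * a - z.2 * b, z.1 * b + z.2 * a + z.2 * b)) ?_ ?_ ?_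
  · rintro ⟨x, y⟩ h
    rw [mem_eisensteinReps] at h
    refine ⟨?_, ?_⟩
    · rw [mem_eisensteinReps]
      push_cast
      rw [← hab, ← h]
      ring
    · exact ⟨-y, by rw [← hab]; ring⟩
  · rintro ⟨x, y⟩ ⟨x', y'⟩ - - h
    simp only [Prod.mk.injEq] at h
    obtain ⟨h1, h2⟩ := h
    have hx : (p : ℤ) * x = p * x' := by
      rw [← hab]; linear_combination (a + b) * h1 + b * h2
    have hy : (p : ℤ) * y = p * y' := by
      rw [← hab]; linear_combination a * h2 - b * h1
    rw [mul_left_cancel₀ hp0 hx, mul_left_cancel₀ hp0 hy]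
  · rintro ⟨X, Y⟩ ⟨h, y, hy⟩
    rw [mem_eisensteinReps] at h
    simp only at hy
    -- (a+b)X + bY is the other coordinate of that product; its divisibility by p follows because p
    -- ∤ b.
    have h1 : (p : ℤ) ∣ b * ((a + b) * X + b * Y) :=
      ⟨(a + b) * y + Y, by linear_combination (a + b) * hy + Y * hab⟩
    obtain ⟨x, hx⟩ := (hpZ.dvd_or_dvd h1).resolve_left hb
    have e1 : x * a - -y * b = X := by
      apply mul_left_cancel₀ hp0
      linear_combination -a * hx - b * hy + X * hab
    have e2 : x * b + -y * a + -y * b = Y := by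
      apply mul_left_cancel₀ hp0
      linear_combination -b * hx + (a + b) * hy + Y * hab
    refine ⟨(x, -y), ?_, by simp only [e1, e2]⟩
    rw [mem_eisensteinReps]
    apply mul_left_cancel₀ hp0
    rw [← e1, ← e2] at h
    push_cast at h
    rw [← h, ← hab]
    ring

theorem ncard_eisensteinReps_dvd_dvd {p : ℕ} (hp : p.Prime) (M : ℕ) :
    {z ∈ eisensteinReps (p * (p * M)) | (p : ℤ) ∣ z.1 ∧ (p : ℤ) ∣ z.2}.ncard =
      (eisensteinReps M).ncard := by
  have hp0 : (p : ℤ) ≠ 0 := by exact_mod_cast hp.ne_zero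
  symm
  refine Set.ncard_congr (fun z _ => (p * z.1, p * z.2)) ?_ ?_ ?_
  · rintro ⟨x, y⟩ h
    rw [mem_eisensteinReps] at h
    refine ⟨?_, ⟨x, rfl⟩, ⟨y, rfl⟩⟩
    rw [mem_eisensteinReps]
    push_cast
    rw [← h]
    ring
  · rintro ⟨x, y⟩ ⟨x', y'⟩ - - h
    simp only [Prod.mk.injEq] at h
    rw [mul_left_cancel₀ hp0 h.1, mul_left_cancel₀ hp0 h.2]
  · rintro ⟨X, Y⟩ ⟨h, ⟨x, hx⟩, ⟨y, hy⟩⟩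
    simp only at hx hy
    subst hx hy
    rw [mem_eisensteinReps] at h
    refine ⟨(x, y), ?_, rfl⟩
    rw [mem_eisensteinReps]
    apply mul_left_cancel₀ hp0
    apply mul_left_cancel₀ hp0
    push_cast at h
    rw [← h]
    ring

theorem eisensteinReps_dvd_dvd_eq_empty {p M : ℕ} (hp : p.Prime) (hM : ¬ p ∣ M) :
    {z ∈ eisensteinReps (p * M) | (p : ℤ) ∣ z.1 ∧ (p : ℤ) ∣ z.2} = ∅ := by
  rw [Set.eq_empty_iff_forall_notMem]
  rintro ⟨X, Y⟩ ⟨h, ⟨x, hx⟩, ⟨y, hy⟩⟩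
  simp only at hx hy
  subst hx hy
  rw [mem_eisensteinReps] at h
  apply hM
  have hp0 : (p : ℤ) ≠ 0 := by exact_mod_cast hp.ne_zero
  have : (p : ℤ) ∣ M := ⟨x ^ 2 + x * y + y ^ 2, by
    apply mul_left_cancel₀ hp0
    push_cast at h
    rw [← h]
    ring⟩
  exact_mod_cast this

/-- For p split, every element of norm pM is divisible by π or its conjugate, and by both exactly
when p divides it: inclusion–exclusion. For p inert, p divides every such element. The shape matches
the recursion for divisor sums of χ. -/
theorem ncard_eisensteinReps_prime_mul {p : ℕ} (hp : p.Prime) (h3 : p ≠ 3) (M : ℕ) :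
    ((eisensteinReps (p * M)).ncard : ℤ) = (1 + chiThree p) * (eisensteinReps M).ncard -
      chiThree p * {z ∈ eisensteinReps (p * M) | (p : ℤ) ∣ z.1 ∧ (p : ℤ) ∣ z.2}.ncard := by
  have hmod : p % 3 = 1 ∨ p % 3 = 2 := by
    have : ¬ 3 ∣ p := fun h => h3 ((Nat.prime_dvd_prime_iff_eq Nat.prime_three hp).1 h).symm
    omega
  rcases hmod with h1 | h2
  · obtain ⟨a, b, hab⟩ := exists_eisenstein_eq_prime hp h1
    have hpZ : Prime (p : ℤ) := Nat.prime_iff_prime_int.1 hp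
    -- (a+b, -b) is the conjugate of π.
    have hab' : (a + b) ^ 2 + (a + b) * (-b) + (-b) ^ 2 = p := by rw [← hab]; ring
    set A := {z ∈ eisensteinReps (p * M) | (p : ℤ) ∣ b * z.1 - a * z.2} with hA
    set B := {z ∈ eisensteinReps (p * M) | (p : ℤ) ∣ -b * z.1 - (a + b) * z.2} with hB
    have hb := not_dvd_of_eisenstein_eq_prime hp hab
    -- The two linear forms add up to -(2a+b)y, so this separates π from its conjugate; it uses 4p -
    -- (2a+b)² = 3b².
    have hab2 : ¬ (p : ℤ) ∣ 2 * a + b := by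
      rintro ⟨c, hc⟩
      have h1 : (p : ℤ) ∣ 3 * b ^ 2 := ⟨4 - c * (2 * a + b), by
        linear_combination 4 * hab - (2 * a + b) * hc⟩
      rcases hpZ.dvd_or_dvd h1 with h | h
      · have : p ∣ 3 := by exact_mod_cast h
        exact h3 ((Nat.prime_dvd_prime_iff_eq hp Nat.prime_three).1 this)
      · exact hb (hpZ.dvd_of_dvd_pow h)
    have hU : A ∪ B = eisensteinReps (p * M) := by
      ext ⟨x, y⟩
      constructor
      · rintro (h | h)
        · exact h.1
        · exact h.1
      · intro h
        have h' := mem_eisensteinReps.1 h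
        push_cast at h'
        have hd : (p : ℤ) ∣ (b * x - a * y) * (-b * x - (a + b) * y) :=
          ⟨y ^ 2 - b ^ 2 * M, by linear_combination -b ^ 2 * h' + y ^ 2 * hab⟩
        rcases hpZ.dvd_or_dvd hd with h1 | h1
        · exact Or.inl ⟨h, h1⟩
        · exact Or.inr ⟨h, h1⟩
    have hI : A ∩ B = {z ∈ eisensteinReps (p * M) | (p : ℤ) ∣ z.1 ∧ (p : ℤ) ∣ z.2} := by
      ext ⟨x, y⟩
      constructor
      · rintro ⟨⟨h, h1⟩, ⟨-, h2⟩⟩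
        have h5 : (p : ℤ) ∣ (2 * a + b) * y := by
          have := (dvd_add h1 h2).neg_right
          refine this.trans (dvd_of_eq ?_)
          simp only
          ring
        have hy := (hpZ.dvd_or_dvd h5).resolve_left hab2
        have h6 : (p : ℤ) ∣ b * x := by
          have := dvd_add h1 (hy.mul_left a)
          refine this.trans (dvd_of_eq ?_)
          simp only
          ring
        exact ⟨h, (hpZ.dvd_or_dvd h6).resolve_left hb, hy⟩
      · rintro ⟨h, hx, hy⟩
        exact ⟨⟨h, dvd_sub (hx.mul_left _) (hy.mul_left _)⟩,
          ⟨h, dvd_sub (hx.mul_left _) (hy.mul_left _)⟩⟩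
    have hfin := eisensteinReps_finite (p * M)
    have := Set.ncard_union_add_ncard_inter A B (hfin.subset fun _ h => h.1)
      (hfin.subset fun _ h => h.1)
    rw [hU, hI, ncard_eisensteinReps_mul_dvd hp hab, ncard_eisensteinReps_mul_dvd hp hab'] at this
    rw [chiThree_of_mod_one h1]
    omega
  · have : {z ∈ eisensteinReps (p * M) | (p : ℤ) ∣ z.1 ∧ (p : ℤ) ∣ z.2} =
        eisensteinReps (p * M) := by
      ext ⟨x, y⟩
      refine ⟨fun h => h.1, fun h => ⟨h, ?_⟩⟩
      refine prime_dvd_of_dvd_eisenstein hp h2 ⟨M, ?_⟩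
      have h' := mem_eisensteinReps.1 h
      push_cast at h'
      exact h'
    rw [this, chiThree_of_mod_two h2]
    ring

theorem ncard_eisensteinReps_eq {N : ℕ} (hN : ¬ 3 ∣ N) :
    ((eisensteinReps N).ncard : ℤ) = 6 * ∑ d ∈ N.divisors, chiThree d := by
  induction N using Nat.strong_induction_on with
  | _ N ih =>
  have hN0 : N ≠ 0 := by rintro rfl; simp at hN
  by_cases h1 : N = 1
  · subst h1
    simp [ncard_eisensteinReps_one, chiThree]
  obtain ⟨p, hp, M, rfl⟩ := Nat.exists_prime_and_dvd h1
  have hp3 : p ≠ 3 := by rintro rfl; simp at hN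
  have hM3 : ¬ 3 ∣ M := fun h => hN (h.mul_left p)
  have hM0 : M ≠ 0 := right_ne_zero_of_mul hN0
  have hlt : ∀ m, m ≠ 0 → m < p * m := fun m hm =>
    lt_mul_of_one_lt_left (Nat.pos_of_ne_zero hm) hp.one_lt
  rw [ncard_eisensteinReps_prime_mul hp hp3, ih M (hlt M hM0) hM3]
  by_cases hpM : p ∣ M
  · obtain ⟨m, rfl⟩ := hpM
    have hm0 : m ≠ 0 := right_ne_zero_of_mul hM0
    rw [ncard_eisensteinReps_dvd_dvd hp, sum_divisors_prime_mul_mul chiThree_mul hp hm0,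
      ih m ((hlt m hm0).trans (hlt _ hM0)) (fun h => hM3 (h.mul_left p))]
    ring
  · rw [eisensteinReps_dvd_dvd_eq_empty hp hpM,
      sum_divisors_prime_mul_of_not_dvd chiThree_mul hp hpM, Set.ncard_empty]
    push_cast
    ring

/-! ### A fundamental domain for the units -/

/-- Rotation by a primitive third root of unity, an automorphism of `x ^ 2 + x * y + y ^ 2`. -/
def eisensteinRotation : ℤ × ℤ ≃ ℤ × ℤ where
  toFun z := (-z.1 - z.2, z.1)
  invFun z := (z.2, -z.1 - z.2)
  left_inv z := by ext <;> simp
  right_inv z := by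
    ext
    · change -z.2 - (-z.1 - z.2) = z.1
      ring
    · rfl

/-- Modulo 3 the form is (x-y)², so x-y is ±1 there, and negation swaps the two classes. The
rotation preserves the class and permutes three sectors; 2x+y, x+2y and x-y are all nonzero mod 3,
so no point lies on a boundary. -/
theorem ncard_eisensteinReps_eq_six_mul (n : ℕ) :
    (eisensteinReps (3 * n + 1)).ncard =
      6 * {z ∈ eisensteinReps (3 * n + 1) |
        (z.1 - z.2) % 3 = 1 ∧ 0 < 2 * z.1 + z.2 ∧ 0 < z.1 + 2 * z.2}.ncard := by
  have hfin := eisensteinReps_finite (3 * n + 1)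
  set E := eisensteinReps (3 * n + 1) with hE
  have hrot : ∀ z, z ∈ E ↔ eisensteinRotation z ∈ E := fun z => by
    simp only [hE, eisensteinReps, Set.mem_ofPred_eq, eisensteinRotation, Equiv.coe_fn_mk]
    ring_nf
  have hneg : ∀ z, z ∈ E ↔ Equiv.neg (ℤ × ℤ) z ∈ E := fun z => by
    simp only [hE, eisensteinReps, Set.mem_ofPred_eq, Equiv.neg_apply, Prod.fst_neg, Prod.snd_neg]
    ring_nf
  set H := {z ∈ E | (z.1 - z.2) % 3 = 1} with hH
  set H' := {z ∈ E | (z.1 - z.2) % 3 = 2} with hH'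
  set D₁ := {z ∈ E | (z.1 - z.2) % 3 = 1 ∧ 0 < 2 * z.1 + z.2 ∧ 0 < z.1 + 2 * z.2} with hD₁
  set D₂ := {z ∈ E | (z.1 - z.2) % 3 = 1 ∧ z.1 + 2 * z.2 < 0 ∧ 0 < z.1 - z.2} with hD₂
  set D₃ := {z ∈ E | (z.1 - z.2) % 3 = 1 ∧ z.1 - z.2 < 0 ∧ 2 * z.1 + z.2 < 0} with hD₃
  have c1 : D₂.ncard = D₁.ncard := Set.ncard_eq_of_mem_iff eisensteinRotation fun z => by
    simp only [hD₁, hD₂, Set.mem_sep_iff, ← hrot]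
    simp only [eisensteinRotation, Equiv.coe_fn_mk]
    refine and_congr_right fun _ => ?_
    omega
  have c2 : D₃.ncard = D₂.ncard := Set.ncard_eq_of_mem_iff eisensteinRotation fun z => by
    simp only [hD₂, hD₃, Set.mem_sep_iff, ← hrot]
    simp only [eisensteinRotation, Equiv.coe_fn_mk]
    refine and_congr_right fun _ => ?_
    omega
  have c3 : H'.ncard = H.ncard := Set.ncard_eq_of_mem_iff (Equiv.neg (ℤ × ℤ)) fun z => by
    simp only [hH, hH', Set.mem_sep_iff, ← hneg]
    simp only [Equiv.neg_apply, Prod.fst_neg, Prod.snd_neg]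
    refine and_congr_right fun _ => ?_
    omega
  have u1 : H ∪ H' = E := by
    ext ⟨x, y⟩
    simp only [hH, hH', Set.mem_union, Set.mem_sep_iff, ← and_or_left, and_iff_left_iff_imp]
    intro h
    have h' := mem_eisensteinReps.1 h
    push_cast at h'
    by_contra hcon
    obtain ⟨k, hk⟩ : ∃ k, x - y = 3 * k := ⟨(x - y) / 3, by omega⟩
    obtain rfl : x = y + 3 * k := by omega
    ring_nf at h'
    omega
  have u2 : D₁ ∪ D₂ ∪ D₃ = H := by
    ext ⟨x, y⟩
    simp only [hH, hD₁, hD₂, hD₃, Set.mem_union, Set.mem_sep_iff, ← and_or_left]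
    refine and_congr_right fun _ => ?_
    omega
  have d1 : Disjoint H H' := by
    rw [Set.disjoint_left]
    rintro z ⟨-, h⟩ ⟨-, h'⟩
    omega
  have d2 : Disjoint D₁ D₂ := by
    rw [Set.disjoint_left]
    rintro z ⟨-, h⟩ ⟨-, h'⟩
    omega
  have d3 : Disjoint (D₁ ∪ D₂) D₃ := by
    rw [Set.disjoint_left]
    rintro z (⟨-, h⟩ | ⟨-, h⟩) ⟨-, h'⟩ <;> omega
  have f : ∀ P : ℤ × ℤ → Prop, {z ∈ E | P z}.Finite := fun P => hfin.subset fun _ h => h.1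
  have e1 := Set.ncard_union_eq d1 (f _) (f _)
  have e2 := Set.ncard_union_eq d2 (f _) (f _)
  have e3 := Set.ncard_union_eq d3 ((f _).union (f _)) (f _)
  rw [u1] at e1
  rw [u2] at e3
  omega

theorem ncard_natPairs_eq (n : ℕ) :
    ({q : ℕ × ℕ | q.1 ^ 2 + q.2 ^ 2 + q.2 = n + q.1 * q.2}.ncard : ℤ) =
      ∑ d ∈ (3 * n + 1).divisors, chiThree d := by
  have h1 := ncard_eisensteinReps_eq (N := 3 * n + 1) (by omega)
  rw [ncard_eisensteinReps_eq_six_mul] at h1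
  have h2 : {q : ℕ × ℕ | q.1 ^ 2 + q.2 ^ 2 + q.2 = n + q.1 * q.2}.ncard =
      {z ∈ eisensteinReps (3 * n + 1) |
        (z.1 - z.2) % 3 = 1 ∧ 0 < 2 * z.1 + z.2 ∧ 0 < z.1 + 2 * z.2}.ncard := by
    -- Inverse: 3a = x+2y-1, 3b = 2x+y-2. The congruence makes a, b integral, and with positivity it
    -- makes them nonnegative.
    refine Set.ncard_congr (fun q _ => (2 * (q.2 : ℤ) - q.1 + 1, 2 * (q.1 : ℤ) - q.2)) ?_ ?_ ?_
    · rintro ⟨a, b⟩ h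
      have h' : (a : ℤ) ^ 2 + b ^ 2 + b = n + a * b := by exact_mod_cast h
      refine ⟨?_, ?_⟩
      · rw [mem_eisensteinReps]
        push_cast
        linear_combination 3 * h'
      · simp only
        omega
    · rintro ⟨a, b⟩ ⟨a', b'⟩ - - h
      simp only [Prod.mk.injEq] at h ⊢
      omega
    · rintro ⟨x, y⟩ ⟨h, h3⟩
      simp only at h3
      rw [mem_eisensteinReps] at h
      push_cast at h
      obtain ⟨a, ha⟩ : ∃ a : ℕ, 3 * (a : ℤ) = x + 2 * y - 1 := ⟨((x + 2 * y - 1) / 3).toNat, by omega⟩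
      obtain ⟨b, hb⟩ : ∃ b : ℕ, 3 * (b : ℤ) = 2 * x + y - 2 := ⟨((2 * x + y - 2) / 3).toNat, by omega⟩
      have hx : x = 2 * (b : ℤ) - a + 1 := by omega
      have hy : y = 2 * (a : ℤ) - b := by omega
      refine ⟨(a, b), ?_, by simp only [hx, hy]⟩
      have h' : (a : ℤ) ^ 2 + b ^ 2 + b = n + a * b := by
        rw [hx, hy] at h
        linarith
      exact_mod_cast h'
  rw [h2]
  push_cast at h1
  linarith

theorem Finset.exists_strictMonoOn_image_range (X : Finset ℕ) :
    ∃ e : ℕ → ℕ, StrictMonoOn e (Set.Iio X.card) ∧ (Finset.range X.card).image e = X := by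
  refine ⟨fun m => if h : m < X.card then X.orderEmbOfFin rfl ⟨m, h⟩ else 0, ?_, ?_⟩
  · intro a ha b hb hab
    simp only [Set.mem_Iio] at ha hb
    simpa [ha, hb] using hab
  · ext x
    have := X.range_orderEmbOfFin rfl
    rw [← Finset.mem_coe (s := X), ← this]
    simp only [Finset.mem_image, Finset.mem_range, Set.mem_range]
    constructor
    · rintro ⟨m, hm, rfl⟩
      exact ⟨⟨m, hm⟩, by simp [hm]⟩
    · rintro ⟨⟨m, hm⟩, rfl⟩
      exact ⟨m, hm, by simp [hm]⟩

/-! ### Beta sets of Young diagrams -/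

namespace YoungDiagram

/-- The hook length of the first cell of row `i` of a Young diagram, when that row is not empty. -/
def firstHook (μ : YoungDiagram) (i : ℕ) : ℕ := μ.rowLen i + (μ.colLen 0 - 1 - i)

/-- The set of the hook lengths of the cells in the first column of a Young diagram. -/
def betaSet (μ : YoungDiagram) : Finset ℕ := (Finset.range (μ.colLen 0)).image μ.firstHook

theorem lt_rowLen_iff_lt_colLen {μ : YoungDiagram} {i j : ℕ} : j < μ.rowLen i ↔ i < μ.colLen j :=
  mem_iff_lt_rowLen.symm.trans mem_iff_lt_colLen

theorem rowLen_pos_iff {μ : YoungDiagram} {i : ℕ} : 0 < μ.rowLen i ↔ i < μ.colLen 0 :=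
  lt_rowLen_iff_lt_colLen

theorem mem_betaSet {μ : YoungDiagram} {x : ℕ} :
    x ∈ μ.betaSet ↔ ∃ i < μ.colLen 0, μ.firstHook i = x := by
  simp [betaSet]

theorem zero_notMem_betaSet (μ : YoungDiagram) : 0 ∉ μ.betaSet := by
  rw [mem_betaSet]
  rintro ⟨i, hi, h⟩
  have := rowLen_pos_iff.2 hi
  unfold firstHook at h
  omega

theorem firstHook_lt {μ : YoungDiagram} {i k : ℕ} (hik : i < k) (hk : k < μ.colLen 0) :
    μ.firstHook k < μ.firstHook i := by
  have := μ.rowLen_anti i k hik.le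
  unfold firstHook
  omega

theorem firstHook_lt_iff {μ : YoungDiagram} {i k : ℕ} (hi : i < μ.colLen 0)
    (hk : k < μ.colLen 0) : μ.firstHook k < μ.firstHook i ↔ i < k := by
  refine ⟨fun h => ?_, fun h => firstHook_lt h hk⟩
  rcases lt_trichotomy i k with h' | rfl | h'
  · exact h'
  · exact absurd h (lt_irrefl _)
  · exact absurd h (firstHook_lt h' hi).not_gt

theorem firstHook_injOn (μ : YoungDiagram) :
    Set.InjOn μ.firstHook (Finset.range (μ.colLen 0)) := by
  intro i hi k hk h
  simp only [Finset.coe_range, Set.mem_Iio] at hi hk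
  have h1 := firstHook_lt_iff hi hk
  have h2 := firstHook_lt_iff hk hi
  omega

theorem card_betaSet (μ : YoungDiagram) : μ.betaSet.card = μ.colLen 0 := by
  rw [betaSet, Finset.card_image_of_injOn μ.firstHook_injOn, Finset.card_range]

theorem card_eq_sum_rowLen (μ : YoungDiagram) :
    μ.card = ∑ i ∈ Finset.range (μ.colLen 0), μ.rowLen i := by
  rw [YoungDiagram.card, Finset.card_eq_sum_card_fiberwise (f := Prod.fst)
    (t := Finset.range (μ.colLen 0))]
  · refine Finset.sum_congr rfl fun i _ => ?_
    rw [rowLen_eq_card]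
    rfl
  · rintro ⟨i, j⟩ h
    have h' : (i, 0) ∈ μ := μ.up_left_mem le_rfl (Nat.zero_le j) h
    simpa using mem_iff_lt_colLen.1 h'

theorem sum_betaSet (μ : YoungDiagram) :
    ∑ x ∈ μ.betaSet, x = μ.card + ∑ i ∈ Finset.range (μ.colLen 0), i := by
  rw [betaSet, Finset.sum_image μ.firstHook_injOn, card_eq_sum_rowLen,
    ← Finset.sum_range_reflect (fun i => i), ← Finset.sum_add_distrib]
  rfl

theorem card_filter_firstHook_lt {μ : YoungDiagram} {i : ℕ} (hi : i < μ.colLen 0) :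
    (μ.betaSet.filter (μ.firstHook i < ·)).card = i := by
  have : μ.betaSet.filter (μ.firstHook i < ·) = (Finset.range i).image μ.firstHook := by
    ext x
    simp only [Finset.mem_filter, mem_betaSet, Finset.mem_image, Finset.mem_range]
    constructor
    · rintro ⟨⟨k, hk, rfl⟩, h⟩
      exact ⟨k, (firstHook_lt_iff hk hi).1 h, rfl⟩
    · rintro ⟨k, hk, rfl⟩
      exact ⟨⟨k, hk.trans hi, rfl⟩, firstHook_lt hk hi⟩
  rw [this, Finset.card_image_of_injOn, Finset.card_range]
  refine μ.firstHook_injOn.mono ?_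
  intro k hk
  simp only [Finset.coe_range, Set.mem_Iio] at hk ⊢
  exact hk.trans hi

/-- The row index of a beta number is the count of larger ones, so the diagram can be read off its
beta set alone. -/
theorem mem_iff_exists_mem_betaSet {μ : YoungDiagram} {i j : ℕ} :
    (i, j) ∈ μ ↔ ∃ x ∈ μ.betaSet, (μ.betaSet.filter (x < ·)).card = i ∧
      j + (μ.betaSet.card - 1 - i) < x := by
  rw [card_betaSet]
  constructor
  · intro h
    have hi : i < μ.colLen 0 := mem_iff_lt_colLen.1 (μ.up_left_mem le_rfl (Nat.zero_le j) h)
    refine ⟨μ.firstHook i, mem_betaSet.2 ⟨i, hi, rfl⟩, card_filter_firstHook_lt hi, ?_⟩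
    have := mem_iff_lt_rowLen.1 h
    unfold firstHook
    omega
  · rintro ⟨x, hx, h1, h2⟩
    obtain ⟨k, hk, rfl⟩ := mem_betaSet.1 hx
    rw [card_filter_firstHook_lt hk] at h1
    subst h1
    rw [mem_iff_lt_rowLen]
    unfold firstHook at h2
    omega

theorem betaSet_injective : Function.Injective betaSet := by
  intro μ ν h
  ext ⟨i, j⟩
  rw [mem_cells, mem_cells, mem_iff_exists_mem_betaSet, mem_iff_exists_mem_betaSet, h]

/-- With X listed increasingly as e 0 < e 1 < …, the element e m gives a row of length e m - m.
Since 0 ∉ X, all these rows are nonempty, so the first column has length |X|. -/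
theorem exists_betaSet_eq {X : Finset ℕ} (hX : 0 ∉ X) : ∃ μ : YoungDiagram, μ.betaSet = X := by
  obtain ⟨e, he, heX⟩ := X.exists_strictMonoOn_image_range
  have hpos : ∀ m < X.card, m < e m := by
    intro m hm
    induction m with
    | zero =>
      refine Nat.pos_of_ne_zero fun h0 => hX ?_
      rw [← heX, ← h0]
      exact Finset.mem_image_of_mem e (Finset.mem_range.2 hm)
    | succ m ih =>
      have h1 := ih (by omega)
      have h2 := he (show m ∈ Set.Iio X.card from by simp only [Set.mem_Iio]; omega)
        (show m + 1 ∈ Set.Iio X.card from hm) (Nat.lt_succ_self m)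
      omega
  have hmono : ∀ k m, m + k < X.card → e m + k ≤ e (m + k) := by
    intro k m
    induction k with
    | zero => simp
    | succ k ih =>
      intro hk
      have h1 := ih (by omega)
      have h2 := he (show m + k ∈ Set.Iio X.card from by simp only [Set.mem_Iio]; omega)
        (show m + k + 1 ∈ Set.Iio X.card from hk) (Nat.lt_succ_self _)
      rw [← add_assoc m k 1]
      omega
  let μ : YoungDiagram :=
    { cells := (Finset.range X.card).biUnion fun i =>
        (Finset.range (e (X.card - 1 - i) - (X.card - 1 - i))).image fun j => (i, j)
      isLowerSet := by
        rintro ⟨i, j⟩ ⟨i', j'⟩ hle h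
        obtain ⟨h1, h2⟩ := Prod.mk_le_mk.1 hle
        simp only [Finset.coe_biUnion, Finset.coe_range, Set.mem_Iio, Finset.coe_image,
          Set.mem_iUnion, Set.mem_image, Prod.mk.injEq, exists_prop] at h ⊢
        obtain ⟨k, hi, l, hj, rfl, rfl⟩ := h
        refine ⟨i', by omega, j', ?_, rfl, rfl⟩
        have h3 := hmono (k - i') (X.card - 1 - k) (by omega)
        rw [show X.card - 1 - k + (k - i') = X.card - 1 - i' by omega] at h3
        omega }
  have hmem : ∀ i j, (i, j) ∈ μ ↔
      i < X.card ∧ j < e (X.card - 1 - i) - (X.card - 1 - i) := by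
    intro i j
    rw [← mem_cells]
    simp [μ]
  have hcol : μ.colLen 0 = X.card := by
    have h1 : ∀ i, i < μ.colLen 0 ↔ i < X.card := by
      intro i
      rw [← mem_iff_lt_colLen, hmem]
      refine ⟨fun h => h.1, fun h => ⟨h, ?_⟩⟩
      have := hpos (X.card - 1 - i) (by omega)
      omega
    have h2 := h1 (μ.colLen 0)
    have h3 := h1 X.card
    omega
  have hrow : ∀ i < X.card, μ.rowLen i = e (X.card - 1 - i) - (X.card - 1 - i) := by
    intro i hi
    have h1 : ∀ j, j < μ.rowLen i ↔ j < e (X.card - 1 - i) - (X.card - 1 - i) := by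
      intro j
      rw [← mem_iff_lt_rowLen, hmem]
      exact and_iff_right hi
    have h2 := h1 (μ.rowLen i)
    have h3 := h1 (e (X.card - 1 - i) - (X.card - 1 - i))
    omega
  have hhook : ∀ i < X.card, μ.firstHook i = e (X.card - 1 - i) := by
    intro i hi
    have := hpos (X.card - 1 - i) (by omega)
    rw [firstHook, hrow i hi, hcol]
    omega
  refine ⟨μ, ?_⟩
  ext x
  rw [mem_betaSet, hcol, ← heX, Finset.mem_image]
  simp only [Finset.mem_range, heX]
  constructor
  · rintro ⟨i, hi, rfl⟩
    exact ⟨X.card - 1 - i, by omega, (hhook i hi).symm⟩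
  · rintro ⟨m, hm, rfl⟩
    refine ⟨X.card - 1 - m, by omega, ?_⟩
    rw [hhook _ (by omega), show X.card - 1 - (X.card - 1 - m) = m by omega]

/-! ### Cores in terms of beta sets -/

/-- The natural number outside of the beta set that is attached to column `j`. -/
def columnGap (μ : YoungDiagram) (j : ℕ) : ℕ := μ.colLen 0 - μ.colLen j + j

theorem firstHook_eq_hookLength_add {μ : YoungDiagram} {i j : ℕ} (h : (i, j) ∈ μ) :
    μ.firstHook i = μ.hookLength i j + μ.columnGap j := by
  have h1 := mem_iff_lt_rowLen.1 h
  have h2 := mem_iff_lt_colLen.1 h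
  have h3 := μ.colLen_anti 0 j (Nat.zero_le j)
  unfold firstHook hookLength columnGap
  omega

/-- `firstHook i` exceeds the gap of column j when (i, j) is a cell and is below it otherwise. -/
theorem columnGap_notMem_betaSet (μ : YoungDiagram) (j : ℕ) : μ.columnGap j ∉ μ.betaSet := by
  rw [mem_betaSet]
  rintro ⟨i, hi, h⟩
  have h1 := lt_rowLen_iff_lt_colLen (μ := μ) (i := i) (j := j)
  have h3 := μ.colLen_anti 0 j (Nat.zero_le j)
  unfold firstHook columnGap at h
  omega

theorem exists_columnGap_eq {μ : YoungDiagram} {i x : ℕ} (hi : i < μ.colLen 0)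
    (hx : x < μ.firstHook i) (hxX : x ∉ μ.betaSet) : ∃ j, (i, j) ∈ μ ∧ μ.columnGap j = x := by
  classical
  -- m will be the number of beta numbers above x. The column sought is the number of non-members
  -- below x, namely x - (`colLen 0` - m).
  have hex : ∃ m, μ.colLen 0 ≤ m ∨ μ.firstHook m < x := ⟨μ.colLen 0, Or.inl le_rfl⟩
  obtain ⟨m, hm⟩ : ∃ m, m = Nat.find hex := ⟨_, rfl⟩
  have hm1 : μ.colLen 0 ≤ m ∨ μ.firstHook m < x := hm ▸ Nat.find_spec hex
  have hm2 : ∀ k < m, k < μ.colLen 0 ∧ x < μ.firstHook k := by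
    intro k hk
    have h1 := Nat.find_min hex (hm ▸ hk)
    push Not at h1
    refine ⟨h1.1, lt_of_le_of_ne h1.2 fun h => hxX (mem_betaSet.2 ⟨k, h1.1, h.symm⟩)⟩
  have him : i < m := by
    by_contra hcon
    rcases hm1 with h | h
    · omega
    · rcases (not_lt.1 hcon).lt_or_eq with h' | rfl
      · have := firstHook_lt h' hi
        omega
      · omega
  obtain ⟨h1, h2⟩ := hm2 (m - 1) (by omega)
  have hrow := rowLen_pos_iff (μ := μ) (i := m)
  have h3 := lt_rowLen_iff_lt_colLen (μ := μ) (i := m - 1) (j := x + m - μ.colLen 0)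
  have h4 := lt_rowLen_iff_lt_colLen (μ := μ) (i := m) (j := x + m - μ.colLen 0)
  unfold firstHook at hm1 h2
  have h7 : μ.colLen (x + m - μ.colLen 0) = m := by omega
  refine ⟨x + m - μ.colLen 0, mem_iff_lt_colLen.2 (by omega), ?_⟩
  unfold columnGap
  omega

/-- The hooks of row i are the differences between its beta number and the smaller non-members. A
failure of closure is a hook equal to t; conversely, closure iterated m times excludes the hook tm.
-/
theorem isCore_iff {t : ℕ} (ht : 0 < t) {μ : YoungDiagram} :
    μ.IsCore t ↔ ∀ x, x + t ∈ μ.betaSet → x ∈ μ.betaSet := by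
  constructor
  · intro h x hx
    by_contra hxX
    obtain ⟨i, hi, hix⟩ := mem_betaSet.1 hx
    obtain ⟨j, hij, hj⟩ := exists_columnGap_eq hi (x := x) (by omega) hxX
    have h1 := firstHook_eq_hookLength_add hij
    exact h i j hij ⟨1, by omega⟩
  · rintro h i j hij ⟨m, hm⟩
    have h1 := firstHook_eq_hookLength_add hij
    have hiter : ∀ m x, x + t * m ∈ μ.betaSet → x ∈ μ.betaSet := by
      intro m
      induction m with
      | zero => intro x hx; simpa using hx
      | succ m ih =>
        intro x hx
        exact ih x (h _ (by rwa [mul_add, mul_one, ← add_assoc] at hx))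
    refine μ.columnGap_notMem_betaSet j (hiter m _ ?_)
    refine mem_betaSet.2 ⟨i, mem_iff_lt_colLen.1 (μ.up_left_mem le_rfl (Nat.zero_le j) hij), ?_⟩
    omega

end YoungDiagram

/-! ### Counting three-cores -/

/-- The first `a` natural numbers that are `1` modulo `3` and the first `b` that are `2`. -/
def threeCoreBetaSet (a b : ℕ) : Finset ℕ :=
  (Finset.range a).image (fun i => 3 * i + 1) ∪ (Finset.range b).image (fun i => 3 * i + 2)

theorem mem_threeCoreBetaSet {a b x : ℕ} :
    x ∈ threeCoreBetaSet a b ↔ (x % 3 = 1 ∧ x / 3 < a) ∨ (x % 3 = 2 ∧ x / 3 < b) := by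
  simp only [threeCoreBetaSet, Finset.mem_union, Finset.mem_image, Finset.mem_range]
  refine or_congr ⟨?_, fun h => ⟨x / 3, by omega⟩⟩ ⟨?_, fun h => ⟨x / 3, by omega⟩⟩ <;>
  · rintro ⟨i, hi, rfl⟩
    omega

theorem disjoint_threeCoreBetaSet (a b : ℕ) :
    Disjoint ((Finset.range a).image (fun i => 3 * i + 1))
      ((Finset.range b).image (fun i => 3 * i + 2)) := by
  rw [Finset.disjoint_left]
  intro x hx hx'
  obtain ⟨i, -, rfl⟩ := Finset.mem_image.1 hx
  obtain ⟨j, -, h⟩ := Finset.mem_image.1 hx'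
  omega

theorem card_threeCoreBetaSet (a b : ℕ) : (threeCoreBetaSet a b).card = a + b := by
  rw [threeCoreBetaSet, Finset.card_union_of_disjoint (disjoint_threeCoreBetaSet a b),
    Finset.card_image_of_injective _ (fun i j h => by simpa using h),
    Finset.card_image_of_injective _ (fun i j h => by simpa using h), Finset.card_range,
    Finset.card_range]

theorem sum_threeCoreBetaSet (a b : ℕ) :
    ∑ x ∈ threeCoreBetaSet a b, x + a * b =
      a ^ 2 + b ^ 2 + b + ∑ i ∈ Finset.range (a + b), i := by
  have h1 : ∀ a, 2 * ∑ i ∈ Finset.range a, (3 * i + 1) + a = 3 * a ^ 2 := fun a => by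
    induction a with
    | zero => rfl
    | succ a ih => rw [Finset.sum_range_succ]; linarith
  have h2 : ∀ b, 2 * ∑ i ∈ Finset.range b, (3 * i + 2) = 3 * b ^ 2 + b := fun b => by
    induction b with
    | zero => rfl
    | succ b ih => rw [Finset.sum_range_succ]; linarith
  have h3 : ∀ c, 2 * ∑ i ∈ Finset.range c, i + c = c ^ 2 := fun c => by
    induction c with
    | zero => rfl
    | succ c ih => rw [Finset.sum_range_succ]; linarith
  rw [threeCoreBetaSet, Finset.sum_union (disjoint_threeCoreBetaSet a b),
    Finset.sum_image (fun i _ j _ h => by simpa using h),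
    Finset.sum_image (fun i _ j _ h => by simpa using h)]
  have e1 := h1 a
  have e2 := h2 b
  have e3 := h3 (a + b)
  nlinarith

theorem exists_forall_iff_lt {P : ℕ → Prop} (h : ∀ i, P (i + 1) → P i) (hP : ∃ i, ¬ P i) :
    ∃ a, ∀ i, P i ↔ i < a := by
  classical
  refine ⟨Nat.find hP, fun i => ⟨fun hi => ?_, fun hi => not_not.1 (Nat.find_min hP hi)⟩⟩
  by_contra hcon
  refine Nat.find_spec hP ?_
  have key : ∀ k m, P (m + k) → P m := fun k => by
    induction k with
    | zero => exact fun m hm => hm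
    | succ k ih => exact fun m hm => ih m (h _ hm)
  exact key (i - Nat.find hP) _ (by rwa [Nat.add_sub_cancel' (not_lt.1 hcon)])

/-- Closure under subtracting 3 makes X an initial segment of each residue class; that of 0 is empty
since 0 ∉ X. -/
theorem exists_eq_threeCoreBetaSet {X : Finset ℕ} (h0 : 0 ∉ X) (h : ∀ x, x + 3 ∈ X → x ∈ X) :
    ∃ a b, X = threeCoreBetaSet a b := by
  have hex : ∀ r, ∃ i, 3 * i + r ∉ X := fun r => by
    obtain ⟨N, hN⟩ := X.bddAbove
    refine ⟨N + 1, fun hmem => ?_⟩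
    have := hN hmem
    omega
  have hstep : ∀ r i, 3 * (i + 1) + r ∈ X → 3 * i + r ∈ X := fun r i hi =>
    h _ (by rwa [show 3 * i + r + 3 = 3 * (i + 1) + r by ring])
  obtain ⟨c, hc⟩ := exists_forall_iff_lt (hstep 0) (hex 0)
  obtain ⟨a, ha⟩ := exists_forall_iff_lt (hstep 1) (hex 1)
  obtain ⟨b, hb⟩ := exists_forall_iff_lt (hstep 2) (hex 2)
  have hc0 : c = 0 := by
    by_contra hcon
    exact h0 ((hc 0).2 (by omega))
  refine ⟨a, b, ?_⟩
  ext x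
  rw [mem_threeCoreBetaSet]
  have hx : 3 * (x / 3) + x % 3 = x := Nat.div_add_mod x 3
  have h1 := hc (x / 3)
  have h2 := ha (x / 3)
  have h3 := hb (x / 3)
  have hmod : x % 3 = 0 ∨ x % 3 = 1 ∨ x % 3 = 2 := by omega
  rcases hmod with hm | hm | hm <;> rw [hm] at hx
  · rw [hx] at h1
    rw [h1]
    omega
  · rw [hx] at h2
    rw [h2]
    omega
  · rw [hx] at h3
    rw [h3]
    omega

theorem ncard_threeCores (n : ℕ) :
    {μ : YoungDiagram | μ.IsCore 3 ∧ μ.card = n}.ncard =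
      {q : ℕ × ℕ | q.1 ^ 2 + q.2 ^ 2 + q.2 = n + q.1 * q.2}.ncard := by
  have hD : ∀ q : ℕ × ℕ, ∃ μ : YoungDiagram, μ.betaSet = threeCoreBetaSet q.1 q.2 := fun q =>
    YoungDiagram.exists_betaSet_eq (by simp [mem_threeCoreBetaSet])
  choose D hD using hD
  have hcard : ∀ q, (D q).card + q.1 * q.2 = q.1 ^ 2 + q.2 ^ 2 + q.2 := fun q => by
    have h1 := (D q).sum_betaSet
    have h2 := sum_threeCoreBetaSet q.1 q.2
    rw [← YoungDiagram.card_betaSet, hD, card_threeCoreBetaSet] at h1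
    omega
  symm
  refine Set.ncard_congr (fun q _ => D q) ?_ ?_ ?_
  · rintro q (hq : _ = _)
    refine ⟨?_, ?_⟩
    · rw [YoungDiagram.isCore_iff (by norm_num), hD]
      intro x
      rw [mem_threeCoreBetaSet, mem_threeCoreBetaSet]
      omega
    · have := hcard q
      omega
  · rintro ⟨a, b⟩ ⟨a', b'⟩ - - h
    have h1 : threeCoreBetaSet a b = threeCoreBetaSet a' b' := by
      have h2 := hD (a, b)
      rw [h, hD] at h2
      exact h2.symm
    rw [Finset.ext_iff] at h1
    simp only [mem_threeCoreBetaSet] at h1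
    have e1 := h1 (3 * a + 1)
    have e2 := h1 (3 * a' + 1)
    have e3 := h1 (3 * b + 2)
    have e4 := h1 (3 * b' + 2)
    simp only [Prod.mk.injEq]
    omega
  · rintro μ ⟨hcore, hn⟩
    obtain ⟨a, b, hab⟩ := exists_eq_threeCoreBetaSet μ.zero_notMem_betaSet
      ((YoungDiagram.isCore_iff (by norm_num)).1 hcore)
    have h1 : D (a, b) = μ := YoungDiagram.betaSet_injective (by rw [hD, hab])
    refine ⟨(a, b), ?_, h1⟩
    have := hcard (a, b)
    rw [h1, hn] at this
    exact this.symm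

/-! ### Pairs of three-cores and the final recursion -/

theorem numCorePairs_eq_sum_antidiagonal (t n : ℕ) :
    numCorePairs t n = ∑ q ∈ Finset.HasAntidiagonal.antidiagonal n,
      {μ : YoungDiagram | μ.IsCore t ∧ μ.card = q.1}.ncard *
        {μ : YoungDiagram | μ.IsCore t ∧ μ.card = q.2}.ncard := by
  classical
  have hfin : ∀ m, {μ : YoungDiagram | μ.IsCore t ∧ μ.card = m}.Finite := fun m =>
    (YoungDiagram.finite_card_le m).subset fun μ h => h.2.le
  have h1 : corePairs t n = ↑((Finset.HasAntidiagonal.antidiagonal n).biUnion fun q =>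
      (hfin q.1).toFinset ×ˢ (hfin q.2).toFinset) := by
    ext ⟨μ, ν⟩
    simp only [Finset.coe_biUnion, Set.mem_iUnion, Finset.mem_coe, Finset.mem_product,
      Set.Finite.mem_toFinset, Finset.HasAntidiagonal.mem_antidiagonal, exists_prop]
    constructor
    · rintro ⟨h, hμ, hν⟩
      exact ⟨(μ.card, ν.card), h, ⟨hμ, rfl⟩, ⟨hν, rfl⟩⟩
    · rintro ⟨⟨i, j⟩, h, ⟨hμ, rfl⟩, ⟨hν, rfl⟩⟩
      exact ⟨h, hμ, hν⟩
  rw [numCorePairs, h1, Set.ncard_coe_finset, Finset.card_biUnion]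
  · refine Finset.sum_congr rfl fun q _ => ?_
    rw [Finset.card_product, Set.ncard_eq_toFinset_card _ (hfin q.1),
      Set.ncard_eq_toFinset_card _ (hfin q.2)]
  · rintro ⟨i, j⟩ - ⟨i', j'⟩ - hne
    rw [Function.onFun, Finset.disjoint_left]
    rintro ⟨μ, ν⟩ h h'
    simp only [Finset.mem_product, Set.Finite.mem_toFinset] at h h'
    exact hne (Prod.ext (h.1.2.symm.trans h'.1.2) (h.2.2.symm.trans h'.2.2))

theorem three_mul_numCorePairs (n : ℕ) :
    3 * (numCorePairs 3 n : ℚ) = ∑ d ∈ (3 * n + 2).divisors, (d : ℚ) := by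
  have h : 3 * (numCorePairs 3 n : ℤ) = ∑ d ∈ (3 * n + 2).divisors, (d : ℤ) := by
    rw [← three_mul_sum_antidiagonal_chiThree', numCorePairs_eq_sum_antidiagonal]
    push_cast
    simp only [ncard_threeCores, ncard_natPairs_eq]
  have h' := congrArg (Int.cast : ℤ → ℚ) h
  push_cast at h'
  exact h'

theorem mainTheorem4 (p : ℕ) (hp : p.Prime) (k n : ℕ) :
    (p ≡ 1 [MOD 3] →
      (numCorePairs 3 (p ^ k * n + (2 * p ^ k - 2) / 3) : ℚ) =
        ((p : ℚ) ^ k - 1) / ((p : ℚ) - 1) * (numCorePairs 3 (p * n + (2 * p - 2) / 3) : ℚ) -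
          ((p : ℚ) ^ k - (p : ℚ)) / ((p : ℚ) - 1) * (numCorePairs 3 n : ℚ)) ∧
    (p ≡ 2 [MOD 3] →
      (numCorePairs 3 (p ^ (2 * k) * n + (2 * p ^ (2 * k) - 2) / 3) : ℚ) =
        ((p : ℚ) ^ (2 * k) - 1) / ((p : ℚ) ^ 2 - 1) *
            (numCorePairs 3 (p ^ 2 * n + (2 * p ^ 2 - 2) / 3) : ℚ) -
          ((p : ℚ) ^ (2 * k) - (p : ℚ) ^ 2) / ((p : ℚ) ^ 2 - 1) * (numCorePairs 3 n : ℚ)) := by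
  -- P ≡ 1 mod 3 makes the division by 3 exact.
  have hA : ∀ P, P % 3 = 1 → 3 * (numCorePairs 3 (P * n + (2 * P - 2) / 3) : ℚ) =
      ∑ d ∈ (P * (3 * n + 2)).divisors, (d : ℚ) := fun P hP => by
    rw [three_mul_numCorePairs]
    have : 3 * (P * n + (2 * P - 2) / 3) + 2 = P * (3 * n + 2) := by
      have h1 : 3 * ((2 * P - 2) / 3) = 2 * P - 2 := by omega
      rw [mul_add, h1, add_assoc, Nat.sub_add_cancel (by omega)]
      ring
    rw [this]
  have h0 := three_mul_numCorePairs n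
  have hp1 : (1 : ℚ) < p := by exact_mod_cast hp.one_lt
  have hrec := sum_divisors_prime_pow_mul hp (show 3 * n + 2 ≠ 0 by omega)
  constructor
  · intro h
    have hk : p ^ k ≡ 1 [MOD 3] := by simpa using h.pow k
    have h1 := hrec k
    rw [← hA _ hk, ← hA p h, ← h0] at h1
    have hne : (p : ℚ) - 1 ≠ 0 := by linarith
    field_simp
    linear_combination h1 / 3
  · intro h
    have h2 : p ^ 2 % 3 = 1 := h.pow 2
    have hk : p ^ (2 * k) ≡ 1 [MOD 3] := by
      rw [pow_mul]
      simpa using Nat.ModEq.pow k (show p ^ 2 ≡ 1 [MOD 3] from h2)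
    -- For p ≡ 2 mod 3, p(3n+2) is 1 mod 3, so σ(p(3n+2)) is not supplied by the formula for A_3; it
    -- is eliminated between the exponents 2k and 2.
    have e1 := hrec (2 * k)
    have e2 := hrec 2
    rw [← hA _ hk, ← h0] at e1
    rw [← hA _ h2, ← h0] at e2
    have hne : (p : ℚ) - 1 ≠ 0 := by linarith
    have hne' : (p : ℚ) ^ 2 - 1 ≠ 0 := by nlinarith
    field_simp
    apply mul_left_cancel₀ hne
    linear_combination ((p : ℚ) ^ 2 - 1) / 3 * e1 - ((p : ℚ) ^ (2 * k) - 1) / 3 * e2
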